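/- Lemma 6.3 (lemma:distinguish). Let $\overline{\mathbb Q}$ be the field of algebraic numbers, let $\alpha_0,\dots,\alpha_n\in\overline{\mathbb Q}$ be conjugate over $\mathbb Q$, let $i,j\le n$ be indices with $\alpha_i\ne\alpha_j$, and let $E\subseteq\overline{\mathbb Q}$ be a finite extension of $\mathbb Q$ with $\alpha_i,\alpha_j\in E$. Then there exists an infinite set $D\subseteq\mathbb Q$ such that for every $q\in D$ both of the following hold: $$\sqrt{\alpha_i+q}\notin E\bigl(\sqrt{\alpha_i+r},\sqrt{\alpha_j+r} : r\in D,\ r\neq q\bigr)\bigl(\sqrt{\alpha_j+q}\bigr),$$ $$\sqrt{\alpha_j+q}\notin E\bigl(\sqrt{\alpha_i+r},\sqrt{\alpha_j+r} : r\in D,\ r\neq q\bigr)\bigl(\sqrt{\alpha_i+q}\bigr).$$ Moreover, such a set $D$ can be decided uniformly in $\alpha_0,\dots,\alpha_n$, $i$, $j$ and the generators of $E$. That is, fix any computable presentation of $\overline{\mathbb Q}$ (a bijection of $\mathbb N$ with $\overline{\mathbb Q}$ under which addition and multiplication become computable functions on $\mathbb N$). Then there is a single partial computable $\{0,1\}$-valued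 function $\Phi$ such that, for all $\alpha_0,\dots,\alpha_n$, $i$, $j$ as above and every finite list $g_1,\dots,g_m\in\overline{\mathbb Q}$ for which $E=\mathbb Q(g_1,\dots,g_m)$ contains $\alpha_i$ and $\alpha_j$, there is an infinite set $D\subseteq\mathbb Q$ with the two properties above such that, for every $q\in\mathbb Q$, the computation of $\Phi$ on the codes of $\alpha_0,\dots,\alpha_n$, the indices $i,j$, the codes of $g_1,\dots,g_m$, and the numerator and denominator of $q$ in lowest terms halts with output $1$ if $q\in D$ and with output $0$ if $q\notin D$. -/

import Mathlib

/-- The field of algebraic numbers. -/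
abbrev Qbar : Type := AlgebraicClosure ℚ

/-- The field `E(√x : x ∈ S)`, the subfield of the algebraic numbers generated by `E` and the
square roots of the elements of `S`. Both square roots of each `x` are adjoined; as they differ
by a sign, this is the same as adjoining one of them, whichever it is. -/
noncomputable def adjoinSqrts (E : IntermediateField ℚ Qbar) (S : Set Qbar) : IntermediateField ℚ Qbar :=
  IntermediateField.adjoin ℚ ((E : Set Qbar) ∪ {z | z ^ 2 ∈ S})

/-- The field `E(√(a + r), √(b + r) : r ∈ D, r ≠ q)`. -/
noncomputable def otherSqrtsField (E : IntermediateField ℚ Qbar) (a b : Qbar) (D : Set ℚ) (q : ℚ) :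
    IntermediateField ℚ Qbar :=
  adjoinSqrts E
    {x | ∃ r ∈ D, r ≠ q ∧ (x = a + algebraMap ℚ Qbar r ∨ x = b + algebraMap ℚ Qbar r)}

/-- The set `D` of rational numbers distinguishes `a` from `b` over `E`: for every `q ∈ D`,
`√(a + q) ∉ E(√(a + r), √(b + r) : r ∈ D, r ≠ q)(√(b + q))`, and the same with `a` and `b`
exchanged. (A subfield contains both square roots of an element or none of them.) -/
def Distinguishes (E : IntermediateField ℚ Qbar) (a b : Qbar) (D : Set ℚ) : Prop :=
  ∀ q ∈ D,
    (∀ z : Qbar, z ^ 2 = a + algebraMap ℚ Qbar q →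
      z ∉ adjoinSqrts (otherSqrtsField E a b D q) {b + algebraMap ℚ Qbar q}) ∧
    (∀ z : Qbar, z ^ 2 = b + algebraMap ℚ Qbar q →
      z ∉ adjoinSqrts (otherSqrtsField E a b D q) {a + algebraMap ℚ Qbar q})

/-- A computable presentation (computable copy with domain `ℕ`) of the field of algebraic numbers:
a numbering of its elements, without repetition, in which addition and multiplication are
computable. The number `ν.symm x` is the code of `x`. -/
structure IsComputablePresentation (ν : ℕ ≃ Qbar) : Prop where
  add : Computable₂ fun m n : ℕ => ν.symm (ν m + ν n)
  mul : Computable₂ fun m n : ℕ => ν.symm (ν m * ν n)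

/-! Write a, b for the two conjugates, choose c ≥ 1 with ca an algebraic integer, and let f be the
minimal polynomial of ca over ℤ, which is also that of cb. The set D consists of natural numbers q,
each with a prime p of its own: p is unramified in E, prime to c, divides f(-cq) exactly once, and
divides f(-cr) for no other r in D. Since f(-cq) is c²(a+q)(b+q) times an algebraic integer, some
valuation v over p has v(a+q) = v(p) and is trivial on b+q and on every other radicand. If √(a+q)
lay in the field generated by the other roots, Kummer theory would put √(a+q) times a product of
v-units into E. Its value squares to v(p), while nonzero elements of E have integral powers of v(p)
as values (`sqrt_notMem_of_prime`). The same p serves with a and b exchanged.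

Unramifiedness enters as a congruence x ^ p ^ m ≡ x modulo p for integral multiples of the
generators (`UnramifiedCert`). It passes to the ring they generate, where it lets factors of p be
split off a non-unit until a unit remains (`exists_valuation_eq_pow`). It holds for almost all p
because a separable polynomial stays separable modulo almost all p.

The elements of D are found one at a time. The state holds the last element, the product P of the
primes so far, and the product F of c, |f(0)| and the values |f(-cq)| so far. Requiring P ∣ q makes
the new value congruent to f(0) modulo old primes, and p ∤ F keeps the new prime away from old
values. Such a step always exists (`exists_sqrtStep`).

For uniformity, each condition on a step is semidecidable in the codes, and so is being the minimal
polynomial, because root bounds reduce minimality to a finite check. Unbounded search therefore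
computes the sequence, and since it increases strictly, its first terms decide membership. -/

instance isAlgebraic_Qbar : Algebra.IsAlgebraic ℚ Qbar := AlgebraicClosure.isAlgebraic ℚ

/-! ### Kummer theory for square roots -/

open IntermediateField in
/-- An element of a quadratic extension `F(w)`, `w² ∈ F`, has the form `u + v w`. -/
theorem exists_add_mul_of_mem_adjoin {F : IntermediateField ℚ Qbar} {w z : Qbar}
    (hw : w ^ 2 ∈ F) (hz : z ∈ adjoin ℚ ((F : Set Qbar) ∪ {w})) :
    ∃ u ∈ F, ∃ v ∈ F, z = u + v * w := by
  rw [← IntermediateField.mem_toSubalgebra, adjoin_toSubalgebra_of_isAlgebraic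
    (fun x _ => Algebra.IsAlgebraic.isAlgebraic x)] at hz
  induction hz using Algebra.adjoin_induction with
  | mem x hx =>
    rcases hx with hx | rfl
    · exact ⟨x, hx, 0, F.zero_mem, by simp⟩
    · exact ⟨0, F.zero_mem, 1, F.one_mem, by simp⟩
  | algebraMap r => exact ⟨_, F.algebraMap_mem r, 0, F.zero_mem, by simp⟩
  | add x y _ _ hx hy =>
    obtain ⟨u, hu, v, hv, rfl⟩ := hx
    obtain ⟨u', hu', v', hv', rfl⟩ := hy
    exact ⟨_, F.add_mem hu hu', _, F.add_mem hv hv', by ring⟩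
  | mul x y _ _ hx hy =>
    obtain ⟨u, hu, v, hv, rfl⟩ := hx
    obtain ⟨u', hu', v', hv', rfl⟩ := hy
    exact ⟨u * u' + v * v' * w ^ 2,
      F.add_mem (F.mul_mem hu hu') (F.mul_mem (F.mul_mem hv hv') hw),
      u * v' + v * u', F.add_mem (F.mul_mem hu hv') (F.mul_mem hv hu'), by ring⟩

/-- Kummer theory for a quadratic extension. -/
theorem mem_or_mul_mem_of_sq_mem {F : IntermediateField ℚ Qbar} {w z : Qbar}
    (hw : w ^ 2 ∈ F) (hz2 : z ^ 2 ∈ F)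
    (hz : z ∈ IntermediateField.adjoin ℚ ((F : Set Qbar) ∪ {w})) : z ∈ F ∨ z * w ∈ F := by
  obtain ⟨u, hu, v, hv, rfl⟩ := exists_add_mul_of_mem_adjoin hw hz
  by_cases hwF : w ∈ F
  · exact Or.inl (F.add_mem hu (F.mul_mem hv hwF))
  -- Expanding the square isolates 2uvw in F, so uv ≠ 0 would put w in F.
  have huv : u * v = 0 := by
    by_contra hne
    apply hwF
    have h1 : (u + v * w) ^ 2 - u ^ 2 - v ^ 2 * w ^ 2 ∈ F :=
      F.sub_mem (F.sub_mem hz2 (pow_mem hu 2)) (F.mul_mem (pow_mem hv 2) hw)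
    have h2 : w = ((u + v * w) ^ 2 - u ^ 2 - v ^ 2 * w ^ 2) / (2 * (u * v)) := by
      obtain ⟨hu0, hv0⟩ := mul_ne_zero_iff.mp hne
      field_simp
      ring
    rw [h2]
    exact F.div_mem h1 (F.mul_mem (ofNat_mem F 2) (F.mul_mem hu hv))
  rcases mul_eq_zero.mp huv with rfl | rfl
  · right
    have : (0 + v * w) * w = v * w ^ 2 := by ring
    rw [this]
    exact F.mul_mem hv hw
  · left
    simpa using hu

/-- Adjoining one root w at a time, the quadratic case leaves z or zw in the smaller field. Both
have squares in E, so the induction continues over the same E. -/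
theorem exists_mul_mem_of_mem_adjoin_finset (E : IntermediateField ℚ Qbar) (T : Finset Qbar) :
    (∀ w ∈ T, w ^ 2 ∈ E) → ∀ z : Qbar, z ^ 2 ∈ E →
      z ∈ IntermediateField.adjoin ℚ ((E : Set Qbar) ∪ T) →
      ∃ m ∈ Submonoid.closure (T : Set Qbar), z * m ∈ E := by
  classical
  induction T using Finset.induction_on with
  | empty =>
    intro _ z _ hz
    refine ⟨1, Submonoid.one_mem _, ?_⟩
    simpa using hz
  | insert w T _ ih =>
    intro hT z hz2 hz
    have hT' : ∀ w ∈ T, w ^ 2 ∈ E := fun x hx => hT x (Finset.mem_insert_of_mem hx)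
    have hw : w ^ 2 ∈ E := hT w (Finset.mem_insert_self _ _)
    have hmono : Submonoid.closure (T : Set Qbar) ≤ Submonoid.closure ((insert w T : Finset Qbar) : Set Qbar) :=
      Submonoid.closure_mono (by simp)
    set F := IntermediateField.adjoin ℚ ((E : Set Qbar) ∪ T) with hF
    have hEF : E ≤ F := fun x hx => IntermediateField.subset_adjoin _ _ (Or.inl hx)
    have hz' : z ∈ IntermediateField.adjoin ℚ ((F : Set Qbar) ∪ {w}) := by
      refine IntermediateField.adjoin.mono ℚ _ _ (fun x hx => ?_) hz
      rcases hx with hx | hx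
      · exact Or.inl (hEF hx)
      · rcases Finset.mem_insert.mp hx with rfl | hx
        · exact Or.inr rfl
        · exact Or.inl (IntermediateField.subset_adjoin _ _ (Or.inr hx))
    rcases mem_or_mul_mem_of_sq_mem (hEF hw) (hEF hz2) hz' with h | h
    · obtain ⟨m, hm, hmz⟩ := ih hT' z hz2 h
      exact ⟨m, hmono hm, hmz⟩
    · obtain ⟨m, hm, hmz⟩ := ih hT' (z * w) (by rw [mul_pow]; exact E.mul_mem hz2 hw) h
      refine ⟨w * m, Submonoid.mul_mem _ (Submonoid.subset_closure (by simp)) (hmono hm), ?_⟩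
      rwa [← mul_assoc]

/-- If a square root of an element of `E` lies in `E(√x : x ∈ S)`, it agrees up to square roots of
elements of `S` with an element of `E`. -/
theorem exists_mul_mem_of_mem_adjoinSqrts {E : IntermediateField ℚ Qbar} {S : Set Qbar}
    (hS : ∀ x ∈ S, x ∈ E) {z : Qbar} (hz2 : z ^ 2 ∈ E) (hz : z ∈ adjoinSqrts E S) :
    ∃ m ∈ Submonoid.closure {w : Qbar | w ^ 2 ∈ S}, z * m ∈ E := by
  classical
  obtain ⟨U, hU, hzU⟩ := IntermediateField.exists_finset_of_mem_adjoin hz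
  obtain ⟨m, hm, hmz⟩ := exists_mul_mem_of_mem_adjoin_finset E
    (U.filter fun w => w ^ 2 ∈ S) (fun w hw => hS _ (Finset.mem_filter.mp hw).2) z hz2 (by
      refine IntermediateField.adjoin.mono ℚ _ _ (fun x hx => ?_) hzU
      rcases hU hx with h | h
      · exact Or.inl h
      · exact Or.inr (by simpa using ⟨hx, h⟩))
  exact ⟨m, Submonoid.closure_mono (fun w hw => by
    simpa using (Finset.mem_filter.mp hw).2) hm, hmz⟩

theorem adjoinSqrts_adjoinSqrts_le (E : IntermediateField ℚ Qbar) (S T : Set Qbar) :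
    adjoinSqrts (adjoinSqrts E S) T ≤ adjoinSqrts E (S ∪ T) := by
  refine IntermediateField.adjoin_le_iff.mpr ?_
  rintro x (hx | hx)
  · exact IntermediateField.adjoin.mono ℚ _ _
      (Set.union_subset_union_right _ fun w hw => Or.inl hw) hx
  · exact IntermediateField.subset_adjoin _ _ (Or.inr (Or.inr hx))

/-! ### Valuations over an unramified prime -/

section Valuations

open Polynomial

theorem ValuationSubring.mem_of_isIntegral_int {K : Type*} [Field K] (V : ValuationSubring K)
    {x : K} (hx : IsIntegral ℤ x) : x ∈ V := by
  have h : IsIntegral V x := hx.tower_top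
  obtain ⟨y, hy⟩ := IsIntegrallyClosed.isIntegral_iff.mp h
  rw [← hy]
  exact y.2

theorem ValuationSubring.valuation_le_one_of_isIntegral_int {K : Type*} [Field K]
    (V : ValuationSubring K) {x : K} (hx : IsIntegral ℤ x) : V.valuation x ≤ 1 :=
  (V.valuation_le_one_iff x).mpr (V.mem_of_isIntegral_int hx)

/-- A Bézout relation between p and m would otherwise give 1 a value below 1. -/
theorem ValuationSubring.valuation_int_eq_one {K : Type*} [Field K]
    (V : ValuationSubring K) {p : ℕ} (hp : p.Prime) (hpV : V.valuation (p : K) < 1) {m : ℤ}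
    (hm : ¬ (p : ℤ) ∣ m) : V.valuation (m : K) = 1 := by
  refine le_antisymm ((V.valuation_le_one_iff _).mpr (intCast_mem V m)) (not_lt.mp fun hlt => ?_)
  have hc : IsCoprime (p : ℤ) m :=
    (Prime.coprime_iff_not_dvd (Nat.prime_iff_prime_int.mp hp)).mpr hm
  obtain ⟨u, w, huw⟩ := hc
  have h1 : (u : K) * p + w * m = 1 := by exact_mod_cast congrArg (Int.cast : ℤ → K) huw
  have h2 : V.valuation ((u : K) * p + w * m) < 1 := by
    refine V.valuation.map_add_lt ?_ ?_
    · rw [map_mul, mul_comm]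
      exact mul_lt_one_of_lt_of_le hpV ((V.valuation_le_one_iff _).mpr (intCast_mem V u))
    · rw [map_mul, mul_comm]
      exact mul_lt_one_of_lt_of_le hlt ((V.valuation_le_one_iff _).mpr (intCast_mem V w))
  rw [h1, map_one] at h2
  exact lt_irrefl _ h2

/-- A nonzero algebraic integer divides a nonzero integer. -/
theorem exists_mul_eq_int_of_isIntegral {K : Type*} [Field K] [CharZero K] {x : K}
    (hx : IsIntegral ℤ x) (h0 : x ≠ 0) :
    ∃ w : K, IsIntegral ℤ w ∧ ∃ m : ℤ, m ≠ 0 ∧ x * w = m := by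
  -- The minimal polynomial is X · `divX` plus its constant term; evaluating at x exhibits x as a
  -- divisor of that term.
  refine ⟨-aeval x (minpoly ℤ x).divX, ?_, (minpoly ℤ x).coeff 0,
    fun h => ?_, ?_⟩
  · exact (IsIntegral.of_mem_of_fg (Algebra.adjoin ℤ {x}) hx.fg_adjoin_singleton _
      (aeval_mem_adjoin_singleton ℤ x)).neg
  · have hQ := minpoly.coeff_zero_ne_zero (A := ℚ) hx.tower_top h0
    rw [minpoly.isIntegrallyClosed_eq_field_fractions' ℚ hx, coeff_map, h, map_zero] at hQ
    exact hQ rfl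
  · have h : aeval x ((minpoly ℤ x).divX * X + C ((minpoly ℤ x).coeff 0)) = 0 := by
      rw [divX_mul_X_add, minpoly.aeval]
    rw [map_add, map_mul, aeval_X, aeval_C, eq_intCast] at h
    linear_combination -h

/-- If `x ^ N ≡ x` modulo `p` in the subring `R` of algebraic integers, the values on `R` of a
valuation over `p` are powers of the value of `p`. -/
theorem exists_valuation_eq_pow {K : Type*} [Field K] [CharZero K] (V : ValuationSubring K)
    {p : ℕ} (hp : p.Prime) (hpV : V.valuation (p : K) < 1) (R : Subring K)
    (hint : ∀ x ∈ R, IsIntegral ℤ x) {N : ℕ} (hN : 2 ≤ N)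
    (hR : ∀ x ∈ R, ∃ y ∈ R, x ^ N = x + p * y) {x : K} (hx : x ∈ R) (h0 : x ≠ 0) :
    ∃ k : ℕ, V.valuation x = V.valuation (p : K) ^ k := by
  obtain ⟨w, hw, m, hm, hxw⟩ := exists_mul_eq_int_of_isIntegral (hint x hx) h0
  have hwV := V.valuation_le_one_of_isIntegral_int hw
  -- The descent divides w by a V-unit, which may destroy integrality over ℤ; only v(w) ≤ 1 is
  -- carried along.
  clear hw
  have hp0 : (p : K) ≠ 0 := by exact_mod_cast hp.ne_zero
  -- Descent on |m|, where xw = m: if x is not a unit then v(x) = v(p) v(y), and y divides m / p up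
  -- to V-integral factors.
  induction hn : m.natAbs using Nat.strong_induction_on generalizing x w m with
  | _ n ih =>
  by_cases h1 : V.valuation x = 1
  · exact ⟨0, by simpa using h1⟩
  have hlt : V.valuation x < 1 := lt_of_le_of_ne (V.valuation_le_one_of_isIntegral_int (hint x hx)) h1
  obtain ⟨y, hy, hxy⟩ := hR x hx
  have hu : V.valuation (x ^ (N - 1) - 1) = 1 := by
    rw [← neg_sub, Valuation.map_neg]
    refine V.valuation.map_one_sub_of_lt ?_
    rw [map_pow]
    exact pow_lt_one₀ zero_le hlt (by omega)
  have hu0 : x ^ (N - 1) - 1 ≠ 0 := by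
    intro h
    rw [h, map_zero] at hu
    exact zero_ne_one hu
  have hxu : x * (x ^ (N - 1) - 1) = p * y := by
    have : x ^ N = x * x ^ (N - 1) := by rw [← pow_succ', Nat.sub_add_cancel (by omega)]
    linear_combination hxy - this
  have hdvd : (p : ℤ) ∣ m := by
    by_contra hnd
    have := V.valuation_int_eq_one hp hpV hnd
    rw [← hxw, map_mul] at this
    exact absurd this (mul_lt_one_of_lt_of_le hlt hwV).ne
  obtain ⟨m', rfl⟩ := hdvd
  have hm' : m' ≠ 0 := right_ne_zero_of_mul hm
  have hy0 : y ≠ 0 := by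
    rintro rfl
    rw [mul_zero] at hxu
    exact mul_ne_zero h0 hu0 hxu
  obtain ⟨k, hk⟩ := ih m'.natAbs (by
      rw [← hn, Int.natAbs_mul, Int.natAbs_natCast]
      exact lt_mul_of_one_lt_left (Int.natAbs_pos.mpr hm') hp.one_lt) hy hy0
    (w * (x ^ (N - 1) - 1)⁻¹) m' hm' (by
      field_simp
      push_cast at hxw
      have : (p : K) * (y * w) = p * ((x ^ (N - 1) - 1) * m') := by
        linear_combination -w * hxu + (x ^ (N - 1) - 1) * hxw
      exact mul_left_cancel₀ hp0 this) (by
      rw [map_mul, map_inv₀, hu, inv_one, mul_one]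
      exact hwV) rfl
  refine ⟨k + 1, ?_⟩
  have := congrArg V.valuation hxu
  rw [map_mul, map_mul, hu, mul_one, hk] at this
  rw [this, pow_succ']

/-- Raising a congruence modulo p to a power preserves it, so M may be replaced by any multiple.
This gives all generators a common exponent. -/
theorem exists_pow_prime_pow_mul_eq {K : Type*} [Field K] {R : Subring K} {p M : ℕ} {x y : K}
    (hx : x ∈ R) (hy : y ∈ R) (h : x ^ p ^ M = x + p * y) (k : ℕ) :
    ∃ z ∈ R, x ^ p ^ (M * k) = x + p * z := by
  induction k with
  | zero => exact ⟨0, R.zero_mem, by simp⟩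
  | succ k ih =>
    obtain ⟨z, hz, hxz⟩ := ih
    have hd : (p : R) ∣ ((⟨x, hx⟩ : R) + p * ⟨z, hz⟩) ^ p ^ M - (⟨x, hx⟩ : R) ^ p ^ M :=
      dvd_trans ⟨⟨z, hz⟩, by ring⟩ (sub_dvd_pow_sub_pow _ _ _)
    obtain ⟨t, ht⟩ := hd
    have ht' : (x + p * z) ^ p ^ M - x ^ p ^ M = p * t := by
      simpa using congrArg (Subtype.val : R → K) ht
    refine ⟨y + t, R.add_mem hy t.2, ?_⟩
    rw [Nat.mul_succ, pow_add, pow_mul, hxz]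
    linear_combination ht' + h

/-- The congruence `x ^ p ^ M ≡ x` modulo `p` passes from generators to the subring. -/
theorem forall_mem_closure_pow_eq {K : Type*} [Field K] {p M : ℕ} (hp : p.Prime) (hM : M ≠ 0)
    (X : Set K) (h : ∀ x ∈ X, ∃ y ∈ Subring.closure X, x ^ p ^ M = x + p * y) :
    ∀ x ∈ Subring.closure X, ∃ y ∈ Subring.closure X, x ^ p ^ M = x + p * y := by
  intro x hx
  have hpM : p ^ M ≠ 0 := pow_ne_zero _ hp.ne_zero
  induction hx using Subring.closure_induction with
  | mem x hx => exact h x hx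
  | zero => exact ⟨0, Subring.zero_mem _, by rw [zero_pow hpM]; simp⟩
  | one => exact ⟨0, Subring.zero_mem _, by simp⟩
  | add x y hx hy ihx ihy =>
    obtain ⟨x', hx', hxx⟩ := ihx
    obtain ⟨y', hy', hyy⟩ := ihy
    obtain ⟨r, hr⟩ := exists_add_pow_prime_pow_eq hp (⟨x, hx⟩ : Subring.closure X) ⟨y, hy⟩ M
    have hr' : (x + y) ^ p ^ M = x ^ p ^ M + y ^ p ^ M + p * x * y * r := by
      simpa using congrArg Subtype.val hr
    refine ⟨x' + y' + x * y * r, Subring.add_mem _ (Subring.add_mem _ hx' hy')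
      (Subring.mul_mem _ (Subring.mul_mem _ hx hy) r.2), ?_⟩
    rw [hr', hxx, hyy]
    ring
  | neg x hx ihx =>
    obtain ⟨x', hx', hxx⟩ := ihx
    rcases hp.eq_two_or_odd' with rfl | hodd
    -- For p = 2 the exponent is even because M ≠ 0, and x + 2x' = -x + 2(x + x').
    · refine ⟨x + x', Subring.add_mem _ hx hx', ?_⟩
      rw [Even.neg_pow ((Nat.even_pow' hM).mpr even_two), hxx]
      push_cast
      ring
    · refine ⟨-x', Subring.neg_mem _ hx', ?_⟩
      rw [Odd.neg_pow hodd.pow, hxx]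
      ring
  | mul x y hx hy ihx ihy =>
    obtain ⟨x', hx', hxx⟩ := ihx
    obtain ⟨y', hy', hyy⟩ := ihy
    refine ⟨x * y' + x' * y + p * (x' * y'), Subring.add_mem _ (Subring.add_mem _
      (Subring.mul_mem _ hx hy') (Subring.mul_mem _ hx' hy)) (Subring.mul_mem _
      (natCast_mem _ p) (Subring.mul_mem _ hx' hy')), ?_⟩
    rw [mul_pow, hxx, hyy]
    ring

/-- A certificate that the prime `p` is unramified in `ℚ(g)`: for some nonzero integral multiple
`x = e g` and some `m ≥ 1`, the element `x ^ p ^ m - x` is divisible by `p` in `ℤ[x]`. -/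
def UnramifiedCert {K : Type*} [Field K] (g : K) (p : ℕ) : Prop :=
  ∃ e : ℕ, e ≠ 0 ∧ IsIntegral ℤ ((e : K) * g) ∧ ∃ m : ℕ, m ≠ 0 ∧ ∃ h : ℤ[X],
    ((e : K) * g) ^ p ^ m = e * g + p * aeval ((e : K) * g) h

theorem Subring.aeval_int_mem {K : Type*} [Field K] (R : Subring K) {x : K} (hx : x ∈ R)
    (h : ℤ[X]) : aeval x h ∈ R := by
  rw [aeval_eq_sum_range]
  refine Subring.sum_mem _ fun i _ => ?_
  rw [zsmul_eq_mul]
  exact R.mul_mem (intCast_mem R _) (R.pow_mem hx _)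

/-- At a prime that is unramified in `E`, elements of `E` have integral valuation. -/
theorem exists_valuation_mul_pow_eq {K : Type*} [Field K] [CharZero K] [Algebra.IsAlgebraic ℚ K]
    (V : ValuationSubring K)
    {p : ℕ} (hp : p.Prime) (hpV : V.valuation (p : K) < 1) (gens : List K)
    (hg : ∀ g ∈ gens, UnramifiedCert g p) {y : K}
    (hy : y ∈ IntermediateField.adjoin ℚ {x | x ∈ gens}) (hy0 : y ≠ 0) :
    ∃ i j : ℕ, V.valuation y * V.valuation (p : K) ^ i = V.valuation (p : K) ^ j := by
  choose! e he heint m hm h hh using hg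
  set X : Set K := {x | ∃ g ∈ gens, x = (e g : K) * g} with hX
  set R := Subring.closure X with hRdef
  have hXR : ∀ g ∈ gens, (e g : K) * g ∈ R := fun g hg => Subring.subset_closure ⟨g, hg, rfl⟩
  set M := (gens.map m).prod with hMdef
  have hM : M ≠ 0 := by
    rw [hMdef, Ne, List.prod_eq_zero_iff]
    simpa using fun g hg => hm g hg
  have hR : ∀ x ∈ R, ∃ y ∈ R, x ^ p ^ M = x + p * y := by
    refine forall_mem_closure_pow_eq hp hM X ?_
    rintro _ ⟨g, hg, rfl⟩
    obtain ⟨k, hk⟩ : m g ∣ M := List.dvd_prod (List.mem_map_of_mem hg)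
    rw [hk]
    exact exists_pow_prime_pow_mul_eq (hXR g hg) (R.aeval_int_mem (hXR g hg) (h g)) (hh g hg) k
  have hint : ∀ x ∈ R, IsIntegral ℤ x := by
    have : R ≤ (integralClosure ℤ K).toSubring := by
      rw [hRdef, Subring.closure_le]
      rintro _ ⟨g, hg, rfl⟩
      exact heint g hg
    exact fun x hx => this hx
  have hN : 2 ≤ p ^ M := hp.two_le.trans (Nat.le_self_pow hM p)
  -- Every element of E is an element of R divided by a nonzero integer, so its value is a quotient
  -- of two values taken on R.
  have hfrac : ∃ n : ℕ, n ≠ 0 ∧ (n : K) * y ∈ R := by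
    rw [← IntermediateField.mem_toSubalgebra, IntermediateField.adjoin_toSubalgebra_of_isAlgebraic
      (fun x _ => Algebra.IsAlgebraic.isAlgebraic x)] at hy
    clear hy0
    induction hy using Algebra.adjoin_induction with
    | mem x hx => exact ⟨e x, he x hx, hXR x hx⟩
    | algebraMap r =>
      refine ⟨r.den, r.den_nz, ?_⟩
      have : (r.den : K) * algebraMap ℚ K r = (r.num : K) := by
        rw [eq_ratCast]
        exact_mod_cast Rat.den_mul_eq_num r
      rw [this]
      exact intCast_mem R _
    | add x y _ _ hx hy =>
      obtain ⟨n, hn, hx⟩ := hx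
      obtain ⟨n', hn', hy⟩ := hy
      refine ⟨n * n', mul_ne_zero hn hn', ?_⟩
      have : ((n * n' : ℕ) : K) * (x + y) = n' * (n * x) + n * (n' * y) := by
        push_cast; ring
      rw [this]
      exact R.add_mem (R.mul_mem (natCast_mem R _) hx) (R.mul_mem (natCast_mem R _) hy)
    | mul x y _ _ hx hy =>
      obtain ⟨n, hn, hx⟩ := hx
      obtain ⟨n', hn', hy⟩ := hy
      refine ⟨n * n', mul_ne_zero hn hn', ?_⟩
      have : ((n * n' : ℕ) : K) * (x * y) = (n * x) * (n' * y) := by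
        push_cast; ring
      rw [this]
      exact R.mul_mem hx hy
  obtain ⟨n, hn, hny⟩ := hfrac
  have hnK : (n : K) ≠ 0 := by exact_mod_cast hn
  obtain ⟨j, hj⟩ := exists_valuation_eq_pow V hp hpV R hint hN hR hny (mul_ne_zero hnK hy0)
  obtain ⟨i, hi⟩ := exists_valuation_eq_pow V hp hpV R hint hN hR (natCast_mem R n) hnK
  exact ⟨i, j, by rw [← hi, ← hj, map_mul, mul_comm]⟩

/-- If every integral polynomial vanishing at `A` has a value at `x` divisible by `p`, some
valuation over `p` is positive at `A - x`. -/
theorem exists_valuationSubring_sub_lt_one {K : Type*} [Field K] {A : K} {p : ℕ} (hp : p.Prime)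
    (x : ℤ) (h : ∀ G : ℤ[X], aeval A G = 0 → (p : ℤ) ∣ G.eval x) :
    ∃ V : ValuationSubring K, V.valuation (p : K) < 1 ∧ V.valuation (A - x) < 1 := by
  set S : Subring K := (aeval (R := ℤ) A).toRingHom.range with hS
  have hSmem : ∀ P : ℤ[X], aeval A P ∈ S := fun P => ⟨P, rfl⟩
  set a : S := ⟨A - x, by
    have := hSmem (X - C x)
    rwa [map_sub, aeval_X, aeval_C, eq_intCast] at this⟩ with ha
  set I : Ideal S := Ideal.span {(p : S), a} with hI
  -- A relation 1 = P(A) p + Q(A) (A - x) gives a polynomial vanishing at A whose value at x is -1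
  -- modulo p.
  have hI1 : I ≠ ⊤ := by
    intro htop
    have h1 : (1 : S) ∈ I := by rw [htop]; trivial
    obtain ⟨⟨_, P, rfl⟩, ⟨_, Q, rfl⟩, huw⟩ := Ideal.mem_span_pair.mp h1
    have huw' : aeval A P * p + aeval A Q * (A - x) = 1 := by
      simpa using congrArg Subtype.val huw
    have h0 : aeval A (P * C (p : ℤ) + Q * (X - C x) - 1) = 0 := by
      simp [huw']
    have h2 := h _ h0
    have h3 : (p : ℤ) ∣ 1 := by
      have : (1 : ℤ) = P.eval x * p - (P * C (p : ℤ) + Q * (X - C x) - 1).eval x := by simp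
      rw [this]
      exact dvd_sub (dvd_mul_left _ _) h2
    exact (Nat.prime_iff_prime_int.mp hp).not_dvd_one h3
  -- A proper ideal of a subring of K lies in the non-units of some valuation ring.
  obtain ⟨V, _, hV⟩ := I.image_subset_nonunits_valuationSubring hI1
  refine ⟨V, ?_, ?_⟩
  · exact V.mem_nonunits_iff.mp (hV ⟨_, Ideal.subset_span (Or.inl rfl), by simp⟩)
  · exact V.mem_nonunits_iff.mp (hV ⟨_, Ideal.subset_span (Or.inr rfl), rfl⟩)

end Valuations

/-! ### Separating a square root by a prime -/

instance normal_Qbar : Normal ℚ Qbar :=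
  haveI : IsAlgClosure ℚ Qbar := ⟨inferInstance, inferInstance⟩
  IsAlgClosure.normal ℚ Qbar

section Distinguishing

open Polynomial

theorem Valuation.eq_one_of_mul_eq_one {K Γ : Type*} [Field K]
    [LinearOrderedCommGroupWithZero Γ] (v : Valuation K Γ) {x y : K} (hx : v x ≤ 1) (hy : v y ≤ 1)
    (h : v (x * y) = 1) : v x = 1 := by
  rw [map_mul] at h
  refine le_antisymm hx (not_lt.mp fun hlt => ?_)
  exact absurd h (mul_lt_one_of_lt_of_le hlt hy).ne

theorem pow_right_injective_of_pos_of_lt_one {Γ : Type*} [LinearOrderedCommGroupWithZero Γ]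
    {t : Γ} (h0 : t ≠ 0) (h1 : t < 1) : Function.Injective fun n : ℕ => t ^ n := by
  have hanti : StrictAnti fun n : ℕ => t ^ n :=
    fun m n hmn => pow_lt_pow_right_of_lt_one₀ (zero_lt_iff.mpr h0) h1 hmn
  exact hanti.injective

/-- Two distinct integral roots of a polynomial divide its values accordingly. -/
theorem exists_eval_eq_mul {K : Type*} [Field K] {A B : K} (hA : IsIntegral ℤ A)
    (hB : IsIntegral ℤ B) (hAB : A ≠ B) {f : ℤ[X]} (hfA : aeval A f = 0) (hfB : aeval B f = 0)
    (x : ℤ) : ∃ h : K, IsIntegral ℤ h ∧ ((f.eval x : ℤ) : K) = (x - A) * ((x - B) * h) := by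
  -- The factor theorem is applied twice over the domain of algebraic integers, so the cofactor is
  -- integral.
  set S := integralClosure ℤ K
  set A' : S := ⟨A, hA⟩
  set B' : S := ⟨B, hB⟩
  have hroot : ∀ C : S, aeval (C : K) f = 0 → (f.map (algebraMap ℤ S)).IsRoot C := by
    intro C hC
    rw [IsRoot.def, eval_map_algebraMap]
    have : ((aeval C f : S) : K) = aeval (C : K) f := by
      exact (aeval_algebraMap_apply K C f).symm
    exact Subtype.ext (this.trans hC)
  obtain ⟨g, hg⟩ := dvd_iff_isRoot.mpr (hroot A' hfA)
  have hgB : g.IsRoot B' := by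
    have h := hroot B' hfB
    rw [hg, IsRoot.def, eval_mul] at h
    refine (mul_eq_zero.mp h).resolve_left fun h0 => ?_
    rw [eval_sub, eval_X, eval_C, sub_eq_zero] at h0
    exact hAB (congrArg Subtype.val h0).symm
  obtain ⟨k, hk⟩ := dvd_iff_isRoot.mpr hgB
  refine ⟨(k.eval (x : S) : S), (k.eval (x : S)).2, ?_⟩
  have h1 : (f.map (algebraMap ℤ S)).eval (x : S) = ((f.eval x : ℤ) : S) := by
    rw [eval_intCast_map]
    rfl
  rw [hg, hk] at h1
  simp only [eval_mul, eval_sub, eval_X, eval_C] at h1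
  have h2 := congrArg Subtype.val h1
  simpa using h2.symm

/-- A prime `p`, unramified in `E = ℚ(gens)`, that exactly divides the norm of `a + q` and divides
no norm of an `a + r`, separates `√(a + q)` from the other square roots. -/
theorem sqrt_notMem_of_prime {a b : Qbar} (hab : a ≠ b) {gens : List Qbar}
    {E : IntermediateField ℚ Qbar} (hE : E = IntermediateField.adjoin ℚ {x | x ∈ gens})
    (haE : a ∈ E) (hbE : b ∈ E) {c : ℕ} (hc : c ≠ 0) (hA : IsIntegral ℤ ((c : Qbar) * a))
    (hB : IsIntegral ℤ ((c : Qbar) * b)) {f : ℤ[X]}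
    (hf : ∀ G : ℤ[X], aeval ((c : Qbar) * a) G = 0 → f ∣ G)
    (hfA : aeval ((c : Qbar) * a) f = 0) (hfB : aeval ((c : Qbar) * b) f = 0)
    {D : Set ℚ} {n p : ℕ} (hp : p.Prime) (hpc : ¬ p ∣ c)
    (hpn : (p : ℤ) ∣ f.eval (-(c * n : ℤ))) (hpn2 : ¬ (p * p : ℤ) ∣ f.eval (-(c * n : ℤ)))
    (hg : ∀ g ∈ gens, UnramifiedCert g p)
    (hD : ∀ r ∈ D, r ≠ n → ∃ k : ℕ, r = k ∧ ¬ (p : ℤ) ∣ f.eval (-(c * k : ℤ)))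
    {z : Qbar} (hz : z ^ 2 = a + algebraMap ℚ Qbar n) :
    z ∉ adjoinSqrts (otherSqrtsField E a b D n) {b + algebraMap ℚ Qbar n} := by
  intro hmem
  have hcK : (c : Qbar) ≠ 0 := by exact_mod_cast hc
  have hABne : (c : Qbar) * a ≠ c * b := fun h => hab (mul_left_cancel₀ hcK h)
  obtain ⟨V, hpV, hAV⟩ := exists_valuationSubring_sub_lt_one (A := (c : Qbar) * a) hp
    (-(c * n : ℤ)) (fun G hG => hpn.trans ((eval_dvd (hf G hG))))
  set v := V.valuation with hv
  set π := v (p : Qbar) with hπ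
  have hπ0 : π ≠ 0 := (v.ne_zero_iff).mpr (by exact_mod_cast hp.ne_zero)
  have hinj := pow_right_injective_of_pos_of_lt_one hπ0 hpV
  have hvc : v (c : Qbar) = 1 := by
    have := V.valuation_int_eq_one hp hpV (m := c) (by exact_mod_cast hpc)
    simpa using this
  -- Since p ∤ c, the factors of f(-ck) and the radicands have the same values.
  have hval : ∀ (u : Qbar) (k : ℕ), v ((-(c * k : ℤ) : ℤ) - c * u) = v (u + algebraMap ℚ Qbar k) := by
    intro u k
    have : ((-(c * k : ℤ) : ℤ) - c * u : Qbar) = -(c * (u + algebraMap ℚ Qbar k)) := by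
      push_cast
      ring
    rw [this, Valuation.map_neg, map_mul, hvc, one_mul]
  have hle : ∀ (u : Qbar), IsIntegral ℤ ((c : Qbar) * u) → ∀ k : ℕ,
      v (u + algebraMap ℚ Qbar k) ≤ 1 := by
    intro u hu k
    rw [← hval]
    exact V.valuation_le_one_of_isIntegral_int ((isIntegral_algebraMap (R := ℤ)).sub hu)
  -- Here f(-ck) is a unit and a product of V-integral factors, so each factor is a unit.
  have hother : ∀ k : ℕ, ¬ (p : ℤ) ∣ f.eval (-(c * k : ℤ)) →
      v (a + algebraMap ℚ Qbar k) = 1 ∧ v (b + algebraMap ℚ Qbar k) = 1 := by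
    intro k hk
    obtain ⟨h, hh, heq⟩ := exists_eval_eq_mul hA hB hABne hfA hfB (-(c * k : ℤ))
    have h1 := V.valuation_int_eq_one hp hpV hk
    have hh1 := V.valuation_le_one_of_isIntegral_int hh
    rw [heq] at h1
    have ha1 := hle a hA k
    have hb1 := hle b hB k
    rw [← hval] at ha1 hb1
    have hbh : v (((-(c * k : ℤ) : ℤ) - c * b) * h) ≤ 1 := by
      rw [map_mul]; exact mul_le_one' hb1 hh1
    have h2 := v.eq_one_of_mul_eq_one ha1 hbh h1
    have h3 := h1
    rw [← hv, map_mul, h2, one_mul] at h3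
    exact ⟨by rw [← hval]; exact h2, by rw [← hval]; exact v.eq_one_of_mul_eq_one hb1 hh1 h3⟩
  have hexp : ∀ y ∈ E, y ≠ 0 → ∃ i j : ℕ, v y * π ^ i = π ^ j := fun y hy hy0 =>
    exists_valuation_mul_pow_eq V hp hpV gens hg (by rwa [hE] at hy) hy0
  have hQE : ∀ k : ℚ, algebraMap ℚ Qbar k ∈ E := fun k => E.algebraMap_mem k
  -- the valuation of `a + n` is that of `p`, and `b + n` is a unit
  obtain ⟨hva, hvb⟩ : v (a + algebraMap ℚ Qbar n) = π ∧ v (b + algebraMap ℚ Qbar n) = 1 := by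
    obtain ⟨h, hh, heq⟩ := exists_eval_eq_mul hA hB hABne hfA hfB (-(c * n : ℤ))
    obtain ⟨m, hm⟩ := hpn
    have hmp : ¬ (p : ℤ) ∣ m := fun hd => hpn2 (by rw [hm]; exact mul_dvd_mul_left _ hd)
    have hvm := V.valuation_int_eq_one hp hpV hmp
    have hh1 := V.valuation_le_one_of_isIntegral_int hh
    have hb1 := hle b hB n
    have hprod : v (a + algebraMap ℚ Qbar n) * (v (b + algebraMap ℚ Qbar n) * v h) = π := by
      rw [← hval, ← hval, ← map_mul, ← map_mul, ← heq, hm, Int.cast_mul, map_mul, hvm, mul_one,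
        Int.cast_natCast]
    have hlt : v (a + algebraMap ℚ Qbar n) < 1 := by
      rw [← hval, ← neg_sub, Valuation.map_neg]
      exact hAV
    have hge : π ≤ v (a + algebraMap ℚ Qbar n) := by
      rw [← hprod]
      exact mul_le_of_le_one_right' (mul_le_one' hb1 hh1)
    have hne : a + algebraMap ℚ Qbar n ≠ 0 := by
      intro h0
      rw [h0, map_zero] at hge
      exact hπ0 (le_antisymm hge zero_le)
    -- Exact divisibility gives only π ≤ v(a + n) < 1; integrality of values on E then forces
    -- equality with π.
    obtain ⟨i, j, hij⟩ := hexp _ (E.add_mem haE (hQE _)) hne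
    have hanti : StrictAnti fun n : ℕ => π ^ n :=
      fun m n hmn => pow_lt_pow_right_of_lt_one₀ (zero_lt_iff.mpr hπ0) hpV hmn
    have h1 : i < j := by
      have : π ^ j < π ^ i := by
        rw [← hij]
        exact mul_lt_of_lt_one_left (pow_pos (zero_lt_iff.mpr hπ0) i) hlt
      exact hanti.lt_iff_gt.mp this
    have h2 : j ≤ i + 1 := by
      have : π ^ (i + 1) ≤ π ^ j := by
        rw [← hij, pow_succ']
        exact mul_le_mul_left hge _
      exact hanti.le_iff_ge.mp this
    obtain rfl : j = i + 1 := by omega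
    have hva : v (a + algebraMap ℚ Qbar n) = π := by
      rw [pow_succ'] at hij
      exact mul_right_cancel₀ (pow_ne_zero _ hπ0) hij
    refine ⟨hva, ?_⟩
    rw [hva] at hprod
    have h3 : v (b + algebraMap ℚ Qbar n) * v h = 1 := mul_left_cancel₀ hπ0 (by rw [hprod, mul_one])
    exact v.eq_one_of_mul_eq_one hb1 hh1 (by rw [map_mul, h3])
  -- All radicands other than a + n, gathered into a single set of v-units.
  set S : Set Qbar := {x | ∃ r ∈ D, r ≠ (n : ℚ) ∧
    (x = a + algebraMap ℚ Qbar r ∨ x = b + algebraMap ℚ Qbar r)} ∪ {b + algebraMap ℚ Qbar n}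
  have hSE : ∀ x ∈ S, x ∈ E := by
    rintro x (⟨r, -, -, rfl | rfl⟩ | rfl)
    · exact E.add_mem haE (hQE _)
    · exact E.add_mem hbE (hQE _)
    · exact E.add_mem hbE (hQE _)
  have hSv : ∀ x ∈ S, v x = 1 := by
    rintro x (⟨r, hr, hrn, hx⟩ | rfl)
    · obtain ⟨k, rfl, hk⟩ := hD r hr hrn
      rcases hx with rfl | rfl
      · exact (hother k hk).1
      · exact (hother k hk).2
    · exact hvb
  obtain ⟨m, hm, hzm⟩ := exists_mul_mem_of_mem_adjoinSqrts hSE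
    (by rw [hz]; exact E.add_mem haE (hQE _)) (adjoinSqrts_adjoinSqrts_le _ _ _ hmem)
  have hvm : v m = 1 := by
    clear hzm
    induction hm using Submonoid.closure_induction with
    | mem w hw =>
      have := hSv _ hw
      rw [map_pow] at this
      rcases lt_trichotomy (v w) 1 with h | h | h
      · exact absurd this (pow_lt_one₀ zero_le h two_ne_zero).ne
      · exact h
      · exact absurd this (one_lt_pow₀ h two_ne_zero).ne'
    | one => exact map_one v
    | mul x y _ _ hx hy => rw [map_mul, hx, hy, mul_one]
  have hvz : v z ^ 2 = π := by rw [← map_pow, hz, hva]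
  have hz0 : z * m ≠ 0 := by
    intro h0
    have : v (z * m) = 0 := by rw [h0, map_zero]
    rw [map_mul, hvm, mul_one] at this
    rw [this, zero_pow two_ne_zero] at hvz
    exact hπ0 hvz.symm
  obtain ⟨i, j, hij⟩ := hexp _ hzm hz0
  rw [map_mul, hvm, mul_one] at hij
  -- Squaring the value of zm, whose square is π, equates an odd and an even power of π.
  have h4 : π ^ (2 * i + 1) = π ^ (2 * j) := by
    rw [mul_comm 2 j, pow_mul, ← hij, mul_pow, hvz, ← pow_mul, pow_succ', mul_comm 2 i]
  have := hinj h4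
  omega

/-- An automorphism carrying b to a shows that cb and ca have the same minimal polynomial, so the
conditions on p are symmetric in a and b. -/
theorem distinguishes_of_primes {a b : Qbar} (hconj : IsConjRoot ℚ a b) (hab : a ≠ b)
    {gens : List Qbar}
    {E : IntermediateField ℚ Qbar} (hE : E = IntermediateField.adjoin ℚ {x | x ∈ gens})
    (haE : a ∈ E) (hbE : b ∈ E) {c : ℕ} (hc : c ≠ 0) (hA : IsIntegral ℤ ((c : Qbar) * a))
    {D : Set ℚ} (hD : ∀ q ∈ D, ∃ n : ℕ, q = n ∧ ∃ p : ℕ, p.Prime ∧ ¬ p ∣ c ∧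
      (p : ℤ) ∣ (minpoly ℤ ((c : Qbar) * a)).eval (-(c * n : ℤ)) ∧
      ¬ (p * p : ℤ) ∣ (minpoly ℤ ((c : Qbar) * a)).eval (-(c * n : ℤ)) ∧
      (∀ g ∈ gens, UnramifiedCert g p) ∧
      ∀ r ∈ D, r ≠ n → ∃ k : ℕ, r = k ∧
        ¬ (p : ℤ) ∣ (minpoly ℤ ((c : Qbar) * a)).eval (-(c * k : ℤ))) :
    Distinguishes E a b D := by
  obtain ⟨σ, hσ⟩ := hconj.exists_algEquiv
  have hσA : (σ.restrictScalars ℤ) ((c : Qbar) * b) = c * a := by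
    simp [hσ]
  have hmin : minpoly ℤ ((c : Qbar) * b) = minpoly ℤ ((c : Qbar) * a) := by
    rw [← hσA, minpoly.algEquiv_eq]
  have hB : IsIntegral ℤ ((c : Qbar) * b) := by
    have := hA
    rw [← hσA] at this
    exact (isIntegral_algEquiv (σ.restrictScalars ℤ)).mp this
  have hfA : aeval ((c : Qbar) * a) (minpoly ℤ ((c : Qbar) * a)) = 0 := minpoly.aeval _ _
  have hfB : aeval ((c : Qbar) * b) (minpoly ℤ ((c : Qbar) * a)) = 0 := by
    rw [← hmin]; exact minpoly.aeval _ _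
  intro q hq
  obtain ⟨n, rfl, p, hp, hpc, h1, h2, hg, hr⟩ := hD q hq
  refine ⟨fun z hz => sqrt_notMem_of_prime hab hE haE hbE hc hA hB
    (fun G hG => minpoly.isIntegrallyClosed_dvd hA hG) hfA hfB hp hpc h1 h2 hg hr hz,
    fun z hz => ?_⟩
  have hsymm : otherSqrtsField E a b D n = otherSqrtsField E b a D n := by
    simp only [otherSqrtsField, or_comm]
  rw [hsymm]
  exact sqrt_notMem_of_prime hab.symm hE hbE haE hc hB hA
    (fun G hG => by rw [← hmin]; exact minpoly.isIntegrallyClosed_dvd hB hG)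
    hfB hfA hp hpc h1 h2 hg hr hz

end Distinguishing

/-! ### Existence of certified primes and construction of D -/

section Existence

open Polynomial

/-- A Bézout relation over `ℤ` for a separable polynomial. -/
theorem exists_bezout_int {f : ℤ[X]} (hf : (f.map (algebraMap ℤ ℚ)).Separable) :
    ∃ (U V : ℤ[X]) (R : ℤ), R ≠ 0 ∧ U * f + V * derivative f = C R := by
  obtain ⟨u, v, huv⟩ := hf
  obtain ⟨d, hd, hU⟩ := IsLocalization.integerNormalization_spec (nonZeroDivisors ℤ) u
  obtain ⟨e, he, hV⟩ := IsLocalization.integerNormalization_spec (nonZeroDivisors ℤ) v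
  set U := IsLocalization.integerNormalization (nonZeroDivisors ℤ) u
  set V := IsLocalization.integerNormalization (nonZeroDivisors ℤ) v
  refine ⟨C e * U, C d * V, d * e,
    mul_ne_zero (nonZeroDivisors.ne_zero hd) (nonZeroDivisors.ne_zero he), ?_⟩
  apply map_injective (algebraMap ℤ ℚ) (algebraMap ℤ ℚ).injective_int
  have hU' : U.map (algebraMap ℤ ℚ) = C (d : ℚ) * u := by
    rw [hU]; simp [zsmul_eq_mul]
  have hV' : V.map (algebraMap ℤ ℚ) = C (e : ℚ) * v := by
    rw [hV]; simp [zsmul_eq_mul]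
  rw [derivative_map] at huv
  simp only [Polynomial.map_add, Polynomial.map_mul, hU', hV', map_C]
  simp only [eq_intCast, map_mul]
  linear_combination (C (d : ℚ) * C (e : ℚ)) * huv

/-- In a finite reduced ring of characteristic `p`, some iterate of Frobenius is the identity. -/
theorem exists_pow_prime_pow_eq_self (A : Type*) [CommRing A] [Finite A] [IsReduced A] (p : ℕ)
    [Fact p.Prime] [CharP A p] : ∃ n : ℕ, n ≠ 0 ∧ ∀ x : A, x ^ p ^ n = x := by
  have hinj : Function.Injective (frobenius A p) := frobenius_inj A p
  let σ : Equiv.Perm A := Equiv.ofBijective _ (Finite.injective_iff_bijective.mp hinj)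
  refine ⟨orderOf σ, (orderOf_pos σ).ne', fun x => ?_⟩
  have h : (σ ^ orderOf σ) x = x := by rw [pow_orderOf_eq_one]; rfl
  rw [Equiv.Perm.coe_pow] at h
  rw [← iterate_frobenius]
  exact h

/-- The quotient by f is finite, and reduced because f is squarefree. Some iterate of Frobenius thus
fixes the class of X. -/
theorem exists_dvd_X_pow_sub_X {p : ℕ} [Fact p.Prime] {f : (ZMod p)[X]} (hf : f.Separable)
    (hdeg : f.natDegree ≠ 0) : ∃ n : ℕ, n ≠ 0 ∧ f ∣ X ^ p ^ n - X := by
  have hf0 : f ≠ 0 := by rintro rfl; simp at hdeg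
  have hred : IsReduced (AdjoinRoot f) :=
    (Ideal.isRadical_iff_quotient_reduced _).mp
      (isRadical_iff_span_singleton.mp hf.squarefree.isRadical)
  have hnt : Nontrivial (AdjoinRoot f) :=
    AdjoinRoot.nontrivial f (by rw [degree_eq_natDegree hf0]; exact_mod_cast hdeg)
  have hchar : CharP (AdjoinRoot f) p := charP_of_injective_algebraMap
    (algebraMap (ZMod p) (AdjoinRoot f)).injective p
  have hmod : Module.Finite (ZMod p) (AdjoinRoot f) :=
    PowerBasis.finite (AdjoinRoot.powerBasis hf0)
  have hfin : Finite (AdjoinRoot f) := Module.finite_of_finite (ZMod p)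
  obtain ⟨n, hn, h⟩ := exists_pow_prime_pow_eq_self (AdjoinRoot f) p
  refine ⟨n, hn, AdjoinRoot.mk_eq_zero.mp ?_⟩
  rw [map_sub, map_pow, AdjoinRoot.mk_X, h, sub_self]

theorem separable_minpoly_int {K : Type*} [Field K] [CharZero K] {x : K} (hx : IsIntegral ℤ x) :
    ((minpoly ℤ x).map (algebraMap ℤ ℚ)).Separable := by
  rw [← minpoly.isIntegrallyClosed_eq_field_fractions' ℚ hx]
  exact (minpoly.irreducible hx.tower_top).separable

theorem exists_natCast_mul_isIntegral {K : Type*} [Field K] [CharZero K]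
    [Algebra.IsAlgebraic ℚ K] (x : K) : ∃ e : ℕ, e ≠ 0 ∧ IsIntegral ℤ ((e : K) * x) := by
  have hx : IsAlgebraic ℤ x :=
    (IsFractionRing.isAlgebraic_iff ℤ ℚ K).mpr (Algebra.IsAlgebraic.isAlgebraic x)
  obtain ⟨y, hy0, hy⟩ := hx.exists_integral_multiple
  refine ⟨y.natAbs, Int.natAbs_ne_zero.mpr hy0, ?_⟩
  rw [zsmul_eq_mul] at hy
  rcases Int.natAbs_eq y with h | h
  · rw [h] at hy
    simpa using hy
  · rw [h] at hy
    simpa using hy.neg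

/-- All but finitely many primes are certified to be unramified in `ℚ(g)`. -/
theorem exists_forall_unramifiedCert {K : Type*} [Field K] [CharZero K]
    [Algebra.IsAlgebraic ℚ K] (g : K) :
    ∃ B : ℕ, B ≠ 0 ∧ ∀ p : ℕ, p.Prime → ¬ p ∣ B → UnramifiedCert g p := by
  obtain ⟨e, he, hint⟩ := exists_natCast_mul_isIntegral g
  set f := minpoly ℤ ((e : K) * g) with hf
  have hmonic : f.Monic := minpoly.monic hint
  obtain ⟨U, V, R, hR, hUV⟩ := exists_bezout_int (separable_minpoly_int hint)
  -- If p ∤ R, the Bézout relation survives reduction modulo p, so f stays separable there.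
  refine ⟨R.natAbs, Int.natAbs_ne_zero.mpr hR, fun p hp hpR => ⟨e, he, hint, ?_⟩⟩
  have : Fact p.Prime := ⟨hp⟩
  set φ := Int.castRingHom (ZMod p)
  have hRp : (φ R) ≠ 0 := by
    intro h
    exact hpR (Int.natCast_dvd.mp ((ZMod.intCast_zmod_eq_zero_iff_dvd R p).mp h))
  have hsep : (f.map φ).Separable := by
    have h := congrArg (Polynomial.map φ) hUV
    simp only [Polynomial.map_add, Polynomial.map_mul, map_C] at h
    refine ⟨C (φ R)⁻¹ * U.map φ, C (φ R)⁻¹ * V.map φ, ?_⟩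
    rw [derivative_map, mul_assoc, mul_assoc, ← mul_add, hf, h, ← C_mul, inv_mul_cancel₀ hRp, C_1]
  have hdeg : (f.map φ).natDegree ≠ 0 := by
    rw [hmonic.natDegree_map]
    exact (minpoly.natDegree_pos hint).ne'
  obtain ⟨m, hm, k', hk'⟩ := exists_dvd_X_pow_sub_X hsep hdeg
  obtain ⟨k, rfl⟩ := map_surjective φ (ZMod.intCast_surjective) k'
  -- The divisibility modulo p is lifted to ℤ[X]; evaluating at eg then kills the multiple of f.
  have hdvd : C (p : ℤ) ∣ X ^ p ^ m - X - f * k := by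
    rw [C_dvd_iff_dvd_coeff]
    intro i
    rw [← ZMod.intCast_zmod_eq_zero_iff_dvd]
    have h0 : (X ^ p ^ m - X - f * k).map φ = 0 := by
      simp [hk']
    have h2 := congrArg (fun P => coeff P i) h0
    rwa [coeff_map] at h2
  obtain ⟨h, hh⟩ := hdvd
  refine ⟨m, hm, h, ?_⟩
  have h1 := congrArg (aeval ((e : K) * g)) hh
  simp only [map_sub, map_mul, map_pow, aeval_X, hf, minpoly.aeval, zero_mul,
    sub_zero, map_natCast] at h1
  linear_combination h1

theorem exists_forall_mem_unramifiedCert {K : Type*} [Field K] [CharZero K]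
    [Algebra.IsAlgebraic ℚ K] (gens : List K) :
    ∃ B : ℕ, B ≠ 0 ∧ ∀ p : ℕ, p.Prime → ¬ p ∣ B → ∀ g ∈ gens, UnramifiedCert g p := by
  choose B hB h using exists_forall_unramifiedCert (K := K)
  refine ⟨(gens.map B).prod, ?_, fun p hp hpB g hg => h g p hp fun hd => hpB ?_⟩
  · rw [Ne, List.prod_eq_zero_iff]
    simpa using fun g _ => hB g
  · exact hd.trans (List.dvd_prod (List.mem_map_of_mem hg))

/-- Infinitely many primes divide values of a nonconstant polynomial, with control on the argument. -/
theorem exists_prime_dvd_eval {f : ℤ[X]} (hf0 : f.eval 0 ≠ 0) (hdeg : f.natDegree ≠ 0)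
    {m : ℤ} (hm : m ≠ 0) :
    ∃ (t p : ℕ), p.Prime ∧ ¬ (p : ℤ) ∣ m ∧ (p : ℤ) ∣ f.eval (f.eval 0 * m * t) := by
  set a := f.eval 0 with ha
  have hne : (f - C a) * (f + C a) ≠ 0 := by
    refine mul_ne_zero (fun h => hdeg ?_) (fun h => hdeg ?_)
    · rw [sub_eq_zero.mp h, natDegree_C]
    · rw [eq_neg_of_add_eq_zero_left h, ← C_neg, natDegree_C]
  -- Avoiding the values ±a ensures that the cofactor 1 + mts of a is not ±1. Its prime divisors
  -- cannot divide m.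
  obtain ⟨t, ht⟩ : ∃ t : ℕ, ((f - C a) * (f + C a)).eval (a * m * t) ≠ 0 := by
    by_contra! hall
    refine hne (eq_zero_of_infinite_isRoot _ ?_)
    refine Set.Infinite.mono ?_ (Set.infinite_range_of_injective
      (f := fun t : ℕ => a * m * (t : ℤ)) fun s t hst => ?_)
    · rintro _ ⟨t, rfl⟩
      exact hall t
    · exact_mod_cast mul_left_cancel₀ (mul_ne_zero hf0 hm) hst
  have hd : a * m * t ∣ f.eval (a * m * t) - a := by
    simpa [ha] using sub_dvd_eval_sub (a * m * t) 0 f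
  obtain ⟨s, hs⟩ := hd
  have hval : f.eval (a * m * t) = a * (1 + m * t * s) := by linear_combination hs
  have hunit : (1 + m * t * s).natAbs ≠ 1 := by
    intro h
    apply ht
    rw [eval_mul, eval_sub, eval_add, eval_C, hval]
    rcases Int.natAbs_eq (1 + m * t * s) with h' | h' <;> rw [h', h] <;> simp
  obtain ⟨p, hp, hpd⟩ := Nat.exists_prime_and_dvd hunit
  have hpd' : (p : ℤ) ∣ 1 + m * t * s := Int.natCast_dvd.mpr hpd
  refine ⟨t, p, hp, fun hpm => ?_, by rw [hval]; exact hpd'.mul_left a⟩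
  have : (p : ℤ) ∣ 1 := by
    have h2 := dvd_sub hpd' (hpm.mul_right (t * s))
    ring_nf at h2
    exact h2
  exact (Nat.prime_iff_prime_int.mp hp).not_dvd_one this

/-- One step of the construction: from the state `(last, P, F)` to the next element `q`, with its
prime `p` and `n = |f(-c q)|`. -/
def SqrtStep {K : Type*} [Field K] (f : ℤ[X]) (c : ℕ) (gens : List K) (s : ℕ × ℕ × ℕ) (q p n : ℕ) : Prop :=
  s.1 < q ∧ s.2.1 ∣ q ∧ p.Prime ∧ ¬ p ∣ s.2.2 ∧ (f.eval (-(c * q : ℤ))).natAbs = n ∧ p ∣ n ∧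
    ¬ p * p ∣ n ∧ ∀ g ∈ gens, UnramifiedCert g p

/-- Prime divisors of values of f supply p and a first q₀ outside a finite set of bad primes. If p²
divides the value, shifting q₀ by pP repairs this without disturbing the other congruences, because
f' is nonzero modulo p there. -/
theorem exists_sqrtStep {K : Type*} [Field K] [CharZero K] [Algebra.IsAlgebraic ℚ K] {f : ℤ[X]} (hf0 : f.eval 0 ≠ 0) (hdeg : f.natDegree ≠ 0)
    (hsep : (f.map (algebraMap ℤ ℚ)).Separable) {c : ℕ} (hc : c ≠ 0) (gens : List K)
    {s : ℕ × ℕ × ℕ} (hs1 : s.2.1 ≠ 0) (hs2 : s.2.2 ≠ 0) :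
    ∃ q p n : ℕ, SqrtStep f c gens s q p n := by
  obtain ⟨last, P, F⟩ := s
  simp only at hs1 hs2
  obtain ⟨U, V, R, hR, hUV⟩ := exists_bezout_int hsep
  obtain ⟨B, hB, hcert⟩ := exists_forall_mem_unramifiedCert gens
  set a := f.eval 0 with ha
  have hcZ : (c : ℤ) ≠ 0 := by exact_mod_cast hc
  have hFBP : ((F * B * P : ℕ) : ℤ) ≠ 0 := by
    exact_mod_cast mul_ne_zero (mul_ne_zero hs2 hB) hs1
  -- The factors are what p must avoid. The sign, the square and the extra a make the argument -c q₀
  -- with q₀ = a²R²FBPt, a natural number divisible by P.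
  have hm0 : -(((F * B * P : ℕ) : ℤ) * R ^ 2 * c * a) ≠ 0 :=
    neg_ne_zero.mpr (mul_ne_zero (mul_ne_zero (mul_ne_zero hFBP (pow_ne_zero 2 hR)) hcZ) hf0)
  obtain ⟨t, p, hp, hpm, hpf⟩ := exists_prime_dvd_eval hf0 hdeg hm0
  rw [← ha] at hpf
  have hpZ : Prime (p : ℤ) := Nat.prime_iff_prime_int.mp hp
  have hpF : ¬ p ∣ F := fun h => hpm ((Int.natCast_dvd_natCast.mpr h).trans
    ⟨-(B * P * R ^ 2 * c * a), by push_cast; ring⟩)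
  have hpB : ¬ p ∣ B := fun h => hpm ((Int.natCast_dvd_natCast.mpr h).trans
    ⟨-(F * P * R ^ 2 * c * a), by push_cast; ring⟩)
  have hpP : ¬ (p : ℤ) ∣ P := fun h => hpm (h.trans ⟨-(F * B * R ^ 2 * c * a), by push_cast; ring⟩)
  have hpR : ¬ (p : ℤ) ∣ R := fun h => hpm (h.trans ⟨-(F * B * P * R * c * a), by push_cast; ring⟩)
  have hpc : ¬ (p : ℤ) ∣ c := fun h => hpm (h.trans ⟨-(F * B * P * R ^ 2 * a), by push_cast; ring⟩)
  obtain ⟨q₀, hq₀⟩ : ∃ q₀ : ℕ, a ^ 2 * R ^ 2 * ((F * B * P : ℕ) : ℤ) * t = q₀ :=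
    Int.eq_ofNat_of_zero_le (by positivity)
  have hPq₀ : (P : ℤ) ∣ q₀ := ⟨a ^ 2 * R ^ 2 * (F * B) * t, by rw [← hq₀]; push_cast; ring⟩
  have harg : a * -(((F * B * P : ℕ) : ℤ) * R ^ 2 * c * a) * t = -(c * q₀) := by
    rw [← hq₀]; ring
  rw [harg] at hpf
  have hpk : ∀ k : ℕ, (p : ℤ) ∣ f.eval (-(c * ((q₀ + p * P * k : ℕ) : ℤ))) := by
    intro k
    have h1 : (p : ℤ) ∣ -(c * ((q₀ + p * P * k : ℕ) : ℤ)) - -(c * q₀) :=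
      ⟨-(c * P * k), by push_cast; ring⟩
    have h2 := dvd_add (h1.trans (sub_dvd_eval_sub _ _ f)) hpf
    rwa [sub_add_cancel] at h2
  have hstep : ∀ k : ℕ, (p * p : ℤ) ∣ f.eval (-(c * ((q₀ + p * P * k : ℕ) : ℤ))) →
      ¬ (p * p : ℤ) ∣ f.eval (-(c * ((q₀ + p * P * (k + 1) : ℕ) : ℤ))) := by
    intro k h1 h2
    set y : ℤ := -(c * ((q₀ + p * P * k : ℕ) : ℤ)) with hy
    have hy' : -(c * ((q₀ + p * P * (k + 1) : ℕ) : ℤ)) = y + -(c * p * P) := by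
      rw [hy]; push_cast; ring
    -- If p² divided two consecutive values, Taylor expansion would give p ∣ f'(y) c P; then p ∣
    -- f'(y), and with p ∣ f(y) the Bézout relation gives p ∣ R.
    obtain ⟨w, hw⟩ := f.binomExpansion y (-(c * p * P))
    rw [hy', hw] at h2
    have h3 : (p * p : ℤ) ∣ p * (f.derivative.eval y * (c * P)) := by
      obtain ⟨u, hu⟩ := h1
      obtain ⟨u', hu'⟩ := h2
      exact ⟨u - u' + w * (c * P) ^ 2, by linear_combination hu - hu'⟩
    have h4 : (p : ℤ) ∣ f.derivative.eval y * (c * P) :=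
      (mul_dvd_mul_iff_left hpZ.ne_zero).mp h3
    rcases hpZ.dvd_or_dvd h4 with h5 | h5
    · apply hpR
      have := congrArg (eval y) hUV
      rw [eval_add, eval_mul, eval_mul, eval_C] at this
      rw [← this]
      exact dvd_add ((hpk k).mul_left _) (h5.mul_left _)
    · rcases hpZ.dvd_or_dvd h5 with h6 | h6
      · exact hpc h6
      · exact hpP h6
  -- One of two consecutive k works; starting after `last` makes the new element exceed it, since pP
  -- ≥ 1.
  obtain ⟨k, hk, hkp⟩ : ∃ k : ℕ, last < k ∧
      ¬ (p * p : ℤ) ∣ f.eval (-(c * ((q₀ + p * P * k : ℕ) : ℤ))) := by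
    by_cases h : (p * p : ℤ) ∣ f.eval (-(c * ((q₀ + p * P * (last + 1) : ℕ) : ℤ)))
    · exact ⟨last + 1 + 1, by omega, hstep _ h⟩
    · exact ⟨last + 1, by omega, h⟩
  refine ⟨q₀ + p * P * k, p, _, ?_, ?_, hp, hpF, rfl, Int.natCast_dvd.mp (hpk k), ?_,
    hcert p hp hpB⟩
  · have : k ≤ p * P * k := Nat.le_mul_of_pos_left k
      (Nat.mul_pos hp.pos (Nat.pos_of_ne_zero hs1))
    simp only
    omega
  · exact dvd_add (Int.natCast_dvd_natCast.mp hPq₀) ⟨p * k, by ring⟩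
  · intro h
    apply hkp
    have := Int.natCast_dvd.mpr h
    push_cast at this ⊢
    exact this

/-- A run of the construction. -/
def IsSqrtRun (f : ℤ[X]) (c : ℕ) (gens : List Qbar) (s : ℕ → ℕ × ℕ × ℕ) : Prop :=
  s 0 = (0, 1, c * (f.eval 0).natAbs) ∧
    ∀ k, ∃ q p n, SqrtStep f c gens (s k) q p n ∧ s (k + 1) = (q, (s k).2.1 * p, (s k).2.2 * n)

namespace IsSqrtRun

variable {f : ℤ[X]} {c : ℕ} {gens : List Qbar} {s : ℕ → ℕ × ℕ × ℕ}

theorem strictMono (h : IsSqrtRun f c gens s) : StrictMono fun k => (s k).1 :=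
  strictMono_nat_of_lt_succ fun k => by
    obtain ⟨q, p, n, hq, hs⟩ := h.2 k
    simp only [hs]
    exact hq.1

theorem dvd_of_le (h : IsSqrtRun f c gens s) {k l : ℕ} (hkl : k ≤ l) :
    (s k).2.1 ∣ (s l).2.1 ∧ (s k).2.2 ∣ (s l).2.2 := by
  induction l, hkl using Nat.le_induction with
  | base => exact ⟨dvd_rfl, dvd_rfl⟩
  | succ l _ ih =>
    obtain ⟨q, p, n, _, hs⟩ := h.2 l
    rw [hs]
    exact ⟨ih.1.mul_right p, ih.2.mul_right n⟩

end IsSqrtRun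

/-- The numbers occurring in a run distinguish `a` from `b`. -/
theorem IsSqrtRun.distinguishes {a b : Qbar} (hconj : IsConjRoot ℚ a b) (hab : a ≠ b)
    {gens : List Qbar}
    {E : IntermediateField ℚ Qbar} (hE : E = IntermediateField.adjoin ℚ {x | x ∈ gens})
    (haE : a ∈ E) (hbE : b ∈ E) {c : ℕ} (hc : c ≠ 0) (hA : IsIntegral ℤ ((c : Qbar) * a))
    {s : ℕ → ℕ × ℕ × ℕ} (h : IsSqrtRun (minpoly ℤ ((c : Qbar) * a)) c gens s) :
    Distinguishes E a b {q | ∃ k, q = ((s (k + 1)).1 : ℚ)} := by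
  set f := minpoly ℤ ((c : Qbar) * a) with hf
  refine distinguishes_of_primes hconj hab hE haE hbE hc hA ?_
  rintro _ ⟨k, rfl⟩
  obtain ⟨q, p, n, ⟨hlt, hPq, hp, hpF, hn, hpn, hpn2, hcert⟩, hs⟩ := h.2 k
  have hdvd : ∀ {m : ℕ} {z : ℤ}, m ∣ z.natAbs ↔ (m : ℤ) ∣ z := Int.natCast_dvd.symm
  -- F starts as c |f(0)| and only acquires factors, so p divides neither c nor f(0).
  have h0 : ¬ p ∣ c * (f.eval 0).natAbs := fun hd => hpF (hd.trans (by
    have := (h.dvd_of_le (Nat.zero_le k)).2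
    rwa [h.1] at this))
  have hs1 : (s (k + 1)).1 = q := by rw [hs]
  refine ⟨q, by rw [hs1], p, hp, fun hd => h0 (hd.mul_right _), ?_, ?_, hcert, ?_⟩
  · rw [← hdvd, hn]; exact hpn
  · intro hd
    apply hpn2
    rw [← hn, hdvd]
    push_cast
    exact hd
  rintro _ ⟨l, rfl⟩ hlk
  refine ⟨(s (l + 1)).1, rfl, ?_⟩
  obtain ⟨q', p', n', ⟨-, hPq', -, -, hn', -⟩, hs'⟩ := h.2 l
  rw [hs'] at hlk ⊢
  simp only at hlk ⊢
  have hne : k ≠ l := by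
    rintro rfl
    rw [hs] at hs'
    exact hlk (by exact_mod_cast (Prod.mk.inj hs').1.symm)
  rcases lt_or_gt_of_ne hne with hkl | hlk
  -- Later elements are multiples of p, so their values are congruent to f(0) modulo p.
  · intro hd
    have hpq' : p ∣ q' := by
      refine dvd_trans ?_ hPq'
      refine dvd_trans ?_ (h.dvd_of_le hkl).1
      rw [hs]
      exact dvd_mul_left _ _
    have h1 : (p : ℤ) ∣ f.eval (-(c * q' : ℤ)) - f.eval 0 := by
      refine dvd_trans ?_ (sub_dvd_eval_sub _ _ f)
      rw [sub_zero, dvd_neg]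
      exact (Int.natCast_dvd_natCast.mpr hpq').mul_left _
    have h2 : (p : ℤ) ∣ f.eval 0 := by
      have := dvd_sub hd h1
      rwa [sub_sub_cancel] at this
    exact h0 ((hdvd.mpr h2).mul_left _)
  -- Values at earlier elements are factors of the F that p had to avoid.
  · intro hd
    apply hpF
    rw [← hdvd, hn'] at hd
    refine hd.trans (dvd_trans ?_ (h.dvd_of_le (Nat.succ_le_of_lt hlk)).2)
    rw [hs']
    exact dvd_mul_left _ _

theorem IsSqrtRun.infinite {f : ℤ[X]} {c : ℕ} {gens : List Qbar} {s : ℕ → ℕ × ℕ × ℕ}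
    (h : IsSqrtRun f c gens s) : {q : ℚ | ∃ k, q = ((s (k + 1)).1 : ℚ)}.Infinite := by
  refine (Set.infinite_range_of_injective (f := fun k => ((s (k + 1)).1 : ℚ)) ?_).mono ?_
  · intro k l hkl
    have := h.strictMono.injective (Nat.cast_injective hkl)
    omega
  · rintro _ ⟨k, rfl⟩
    exact ⟨k, rfl⟩

end Existence

/-! ### Coefficient bounds for monic divisors -/

section MinpolyCertificate

open Polynomial

/-- Cauchy's bound is 1 plus the largest lower coefficient, here at most T - 1. The maximum with 1
covers degree zero. -/
theorem Polynomial.norm_le_of_isRoot_of_natAbs_coeff_lt {f : ℤ[X]} (hf : f.Monic) {T : ℕ}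
    (hT : ∀ i < f.natDegree, (f.coeff i).natAbs < T) {z : ℂ}
    (hz : (f.map (algebraMap ℤ ℂ)).IsRoot z) : ‖z‖ ≤ max (T : ℝ) 1 := by
  have hmon : (f.map (algebraMap ℤ ℂ)).Monic := hf.map _
  have h := hz.norm_lt_cauchyBound hmon.ne_zero
  refine (NNReal.coe_le_coe.mpr h.le).trans ?_
  rw [cauchyBound, hmon.leadingCoeff, hf.natDegree_map]
  simp only [nnnorm_one, div_one]
  push_cast
  by_cases hd : f.natDegree = 0
  · simp [hd]
  have h1 : (Finset.range f.natDegree).sup (fun i => ‖(f.map (algebraMap ℤ ℂ)).coeff i‖₊) ≤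
      ((T - 1 : ℕ) : NNReal) := by
    refine Finset.sup_le fun i hi => ?_
    have := hT i (Finset.mem_range.mp hi)
    rw [coeff_map, ← NNReal.coe_le_coe, coe_nnnorm, eq_intCast, Complex.norm_intCast,
      ← Int.cast_abs, Int.abs_eq_natAbs]
    simp only [Int.cast_natCast, NNReal.coe_natCast, Nat.cast_le]
    omega
  have hT1 : 1 ≤ T := by
    have := hT 0 (Nat.pos_of_ne_zero hd)
    omega
  have h2 : (((Finset.range f.natDegree).sup
      (fun i => ‖(f.map (algebraMap ℤ ℂ)).coeff i‖₊) : NNReal) : ℝ) ≤ (T - 1 : ℕ) := by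
    exact_mod_cast NNReal.coe_le_coe.mpr h1
  rw [Nat.cast_sub hT1] at h2
  refine le_trans ?_ (le_max_left _ _)
  push_cast at h2
  linarith

/-- The coefficients of a monic integral divisor are bounded. -/
theorem Polynomial.natAbs_coeff_le_of_dvd {f g : ℤ[X]} (hf : f.Monic) (hg : g.Monic)
    (hgf : g ∣ f) {T M : ℕ} (hT : ∀ i < f.natDegree, (f.coeff i).natAbs < T)
    (hM : ((T + 1) * 2) ^ f.natDegree ≤ M) (i : ℕ) : (g.coeff i).natAbs ≤ M := by
  have hroots : ∀ z ∈ (g.map (algebraMap ℤ ℂ)).roots, ‖z‖ ≤ max (T : ℝ) 1 := by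
    intro z hz
    exact norm_le_of_isRoot_of_natAbs_coeff_lt hf hT
      ((isRoot_of_mem_roots hz).dvd (Polynomial.map_dvd _ hgf))
  have h := coeff_bdd_of_roots_le (algebraMap ℤ ℂ) hg (IsAlgClosed.splits _)
    (natDegree_le_of_dvd hgf hf.ne_zero) hroots i
  have h1 : ‖(g.map (algebraMap ℤ ℂ)).coeff i‖ = ((g.coeff i).natAbs : ℝ) := by
    rw [coeff_map, eq_intCast, Complex.norm_intCast, ← Int.cast_abs, Int.abs_eq_natAbs,
      Int.cast_natCast]
  rw [h1] at h
  set d := f.natDegree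
  -- The coefficients are symmetric functions of the roots, with at most 2 ^ d terms.
  have h2 : max (max (T : ℝ) 1) 1 ^ d * (d.choose (d / 2) : ℝ) ≤ (((T + 1) * 2) ^ d : ℕ) := by
    push_cast
    rw [mul_pow]
    have hc : (d.choose (d / 2) : ℝ) ≤ 2 ^ d := by exact_mod_cast Nat.choose_le_two_pow d _
    have hT0 : (0 : ℝ) ≤ T := Nat.cast_nonneg T
    gcongr
    simp only [max_le_iff]
    refine ⟨⟨by linarith, by linarith⟩, by linarith⟩
  have h3 := h.trans h2
  have h4 : (g.coeff i).natAbs ≤ ((T + 1) * 2) ^ d := by exact_mod_cast h3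
  exact h4.trans hM

/-- A monic polynomial vanishing at `x` is the minimal polynomial if no monic polynomial of smaller
degree with suitably bounded coefficients vanishes at `x`. -/
theorem eq_minpoly_int_of_forall {K : Type*} [Field K] [CharZero K] {x : K} {f : ℤ[X]}
    (hf : f.Monic) (hfx : aeval x f = 0) {T M : ℕ}
    (hT : ∀ i < f.natDegree, (f.coeff i).natAbs < T) (hM : ((T + 1) * 2) ^ f.natDegree ≤ M)
    (hmin : ∀ g : ℤ[X], g.Monic → g.natDegree < f.natDegree →
      (∀ i, (g.coeff i).natAbs ≤ M) → aeval x g ≠ 0) : f = minpoly ℤ x := by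
  have hx : IsIntegral ℤ x := ⟨f, hf, hfx⟩
  have hdvd : minpoly ℤ x ∣ f := minpoly.isIntegrallyClosed_dvd hx hfx
  have hmon := minpoly.monic hx
  have hle := natDegree_le_of_dvd hdvd hf.ne_zero
  -- The minimal polynomial is a monic divisor of f, so its coefficients lie in the searched box.
  have hge : f.natDegree ≤ (minpoly ℤ x).natDegree := not_lt.mp fun hlt =>
    hmin _ hmon hlt (natAbs_coeff_le_of_dvd hf hmon hdvd hT hM) (minpoly.aeval ℤ x)
  exact eq_of_monic_of_dvd_of_natDegree_le hmon hf hdvd hge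

end MinpolyCertificate

/-! ### Integral polynomials coded by lists of pairs of naturals -/

section PolynomialLists

open Polynomial

/-- The integral polynomial with the list of coefficients `w.1 - w.2`, constant coefficient
first. -/
noncomputable def polyOfList (l : List (ℕ × ℕ)) : ℤ[X] :=
  l.foldr (fun w P => C ((w.1 : ℤ) - w.2) + X * P) 0

/-- The monic polynomial of degree `l.length` with lower coefficients `l`. -/
noncomputable def monicOfList (l : List (ℕ × ℕ)) : ℤ[X] :=
  X ^ l.length + polyOfList l

/-- The lists of `k` pairs of numbers at most `M`. -/
def boxLists (M : ℕ) (k : ℕ) : List (List (ℕ × ℕ)) :=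
  Nat.rec [[]] (fun _ B => B.flatMap fun t => (List.range (M + 1)).flatMap fun u =>
    (List.range (M + 1)).map fun v => (u, v) :: t) k

@[simp]
theorem polyOfList_nil : polyOfList [] = 0 := rfl

@[simp]
theorem polyOfList_cons (w : ℕ × ℕ) (l : List (ℕ × ℕ)) :
    polyOfList (w :: l) = C ((w.1 : ℤ) - w.2) + X * polyOfList l := rfl

theorem mem_boxLists_succ {M k : ℕ} {l : List (ℕ × ℕ)} :
    l ∈ boxLists M (k + 1) ↔ ∃ t ∈ boxLists M k, ∃ u ≤ M, ∃ v ≤ M, (u, v) :: t = l := by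
  simp [boxLists]

theorem length_of_mem_boxLists {M k : ℕ} {l : List (ℕ × ℕ)} (h : l ∈ boxLists M k) :
    l.length = k := by
  induction k generalizing l with
  | zero => simp [boxLists] at h; simp [h]
  | succ k ih =>
    obtain ⟨t, ht, u, -, v, -, rfl⟩ := mem_boxLists_succ.mp h
    simp [ih ht]

theorem exists_mem_boxLists {M k : ℕ} {P : ℤ[X]} (hP : P.degree < k)
    (hM : ∀ i, (P.coeff i).natAbs ≤ M) : ∃ l ∈ boxLists M k, polyOfList l = P := by
  induction k generalizing P with
  | zero =>
    refine ⟨[], by simp [boxLists], ?_⟩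
    rw [degree_lt_iff_coeff_zero] at hP
    exact (Polynomial.ext fun i => by rw [hP i (Nat.zero_le i)]; rfl : P = 0).symm
  | succ k ih =>
    obtain ⟨t, ht, hPt⟩ := ih (P := P.divX) (by
      rw [degree_lt_iff_coeff_zero] at hP ⊢
      intro i hi
      rw [coeff_divX]
      exact hP _ (by omega)) (fun i => by rw [coeff_divX]; exact hM _)
    -- Positive and negative parts of the constant coefficient, each bounded by its absolute value.
    refine ⟨((P.coeff 0).toNat, (-P.coeff 0).toNat) :: t,
      mem_boxLists_succ.mpr ⟨t, ht, _, ?_, _, ?_, rfl⟩, ?_⟩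
    · have := hM 0; omega
    · have := hM 0; omega
    · rw [polyOfList_cons, hPt, Int.toNat_sub_toNat_neg, add_comm, mul_comm, divX_mul_X_add]

theorem exists_polyOfList_eq {k : ℕ} {P : ℤ[X]} (hP : P.degree < k) :
    ∃ l, l.length = k ∧ polyOfList l = P := by
  obtain ⟨l, hl, hlP⟩ := exists_mem_boxLists (M := ∑ i ∈ P.support, (P.coeff i).natAbs) hP
    (fun i => by
      by_cases hi : i ∈ P.support
      · exact Finset.single_le_sum (f := fun i => (P.coeff i).natAbs) (fun _ _ => Nat.zero_le _) hi
      · rw [notMem_support_iff.mp hi]; exact Nat.zero_le _)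
  exact ⟨l, length_of_mem_boxLists hl, hlP⟩

theorem polyOfList_surjective : Function.Surjective polyOfList := fun P => by
  obtain ⟨l, -, h⟩ := exists_polyOfList_eq (k := P.natDegree + 1) (P := P)
    (degree_le_natDegree.trans_lt (by exact_mod_cast Nat.lt_succ_self _))
  exact ⟨l, h⟩

theorem coeff_polyOfList (l : List (ℕ × ℕ)) (i : ℕ) :
    (polyOfList l).coeff i = ((l[i]?.getD (0, 0)).1 : ℤ) - (l[i]?.getD (0, 0)).2 := by
  induction l generalizing i with
  | nil => simp
  | cons w l ih =>
    cases i with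
    | zero => simp
    | succ i => simp [ih]

theorem degree_polyOfList_lt (l : List (ℕ × ℕ)) : (polyOfList l).degree < l.length := by
  rw [degree_lt_iff_coeff_zero]
  intro i hi
  rw [coeff_polyOfList, List.getElem?_eq_none hi]
  simp

theorem monic_monicOfList (l : List (ℕ × ℕ)) : (monicOfList l).Monic :=
  monic_X_pow_add (degree_polyOfList_lt l)

theorem natDegree_monicOfList (l : List (ℕ × ℕ)) : (monicOfList l).natDegree = l.length := by
  refine natDegree_eq_of_degree_eq_some ?_
  rw [monicOfList, degree_add_eq_left_of_degree_lt, degree_X_pow]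
  rw [degree_X_pow]
  exact degree_polyOfList_lt l

theorem coeff_monicOfList {l : List (ℕ × ℕ)} {i : ℕ} (hi : i < l.length) :
    (monicOfList l).coeff i = (l[i].1 : ℤ) - l[i].2 := by
  rw [monicOfList, coeff_add, coeff_X_pow, if_neg hi.ne, zero_add, coeff_polyOfList,
    List.getElem?_eq_getElem hi]
  rfl

theorem Polynomial.Monic.degree_sub_X_pow_lt {P : ℤ[X]} (hP : P.Monic) :
    (P - X ^ P.natDegree : ℤ[X]).degree < (P.natDegree : WithBot ℕ) := by
  rw [← degree_eq_natDegree hP.ne_zero]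
  refine degree_sub_lt_left ?_ hP.ne_zero ?_
  · rw [degree_X_pow, degree_eq_natDegree hP.ne_zero]
  · rw [hP.leadingCoeff, (monic_X_pow _).leadingCoeff]

theorem exists_monicOfList_eq {P : ℤ[X]} (hP : P.Monic) : ∃ l, monicOfList l = P := by
  obtain ⟨l, hl, h⟩ := exists_polyOfList_eq hP.degree_sub_X_pow_lt
  exact ⟨l, by rw [monicOfList, hl, h]; ring⟩

theorem exists_mem_boxLists_monicOfList_eq {M : ℕ} {P : ℤ[X]} (hP : P.Monic)
    (hM : ∀ i, (P.coeff i).natAbs ≤ M) :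
    ∃ l ∈ boxLists M P.natDegree, monicOfList l = P := by
  obtain ⟨l, hl, h⟩ := exists_mem_boxLists (M := M) hP.degree_sub_X_pow_lt (fun i => by
    rw [coeff_sub, coeff_X_pow]
    split_ifs with hi
    · subst hi; simp [hP]
    · simpa using hM i)
  exact ⟨l, hl, by rw [monicOfList, length_of_mem_boxLists hl, h]; ring⟩

theorem isIntegral_int_iff_exists_list {K : Type*} [Field K] {x : K} :
    IsIntegral ℤ x ↔ ∃ l, aeval x (monicOfList l) = 0 := by
  constructor
  · rintro ⟨P, hP, hx⟩
    obtain ⟨l, rfl⟩ := exists_monicOfList_eq hP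
    exact ⟨l, hx⟩
  · rintro ⟨l, hl⟩
    exact ⟨_, monic_monicOfList l, hl⟩

/-- A finitely checkable certificate for the minimal polynomial of an algebraic integer. -/
theorem isIntegral_and_minpoly_int_eq_iff {K : Type*} [Field K] [CharZero K] {x : K}
    {l : List (ℕ × ℕ)} :
    (IsIntegral ℤ x ∧ minpoly ℤ x = monicOfList l) ↔
      aeval x (monicOfList l) = 0 ∧ ∃ T M : ℕ, (∀ w ∈ l, w.1 + w.2 < T) ∧
        ((T + 1) * 2) ^ l.length ≤ M ∧
        ∀ k ∈ List.range l.length, ∀ t ∈ boxLists M k, aeval x (monicOfList t) ≠ 0 := by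
  constructor
  · rintro ⟨hx, hl⟩
    refine ⟨by rw [← hl]; exact minpoly.aeval ℤ x, (l.map fun w => w.1 + w.2).sum + 1, _,
      fun w hw => ?_, le_rfl, fun k hk t ht h0 => ?_⟩
    · exact Nat.lt_succ_of_le (List.single_le_sum (fun _ _ => Nat.zero_le _) _
        (List.mem_map_of_mem hw))
    · have h1 := minpoly.isIntegrallyClosed_dvd hx h0
      have h2 := natDegree_le_of_dvd h1 (monic_monicOfList t).ne_zero
      rw [hl, natDegree_monicOfList, natDegree_monicOfList, length_of_mem_boxLists ht] at h2
      exact absurd (List.mem_range.mp hk) (not_lt.mpr h2)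
  -- Any sufficiently large T and M do, so both may be found by search; u + v bounds |u - v|.
  · rintro ⟨hx, T, M, hT, hM, hmin⟩
    refine ⟨⟨_, monic_monicOfList l, hx⟩, (eq_minpoly_int_of_forall (monic_monicOfList l) hx
      (T := T) (M := M) (fun i hi => ?_) (by rwa [natDegree_monicOfList]) fun g hg hdeg hcoeff => ?_).symm⟩
    · rw [natDegree_monicOfList] at hi
      rw [coeff_monicOfList hi]
      have := hT _ (List.getElem_mem hi)
      omega
    · obtain ⟨t, ht, rfl⟩ := exists_mem_boxLists_monicOfList_eq hg hcoeff
      rw [natDegree_monicOfList l] at hdeg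
      exact hmin _ (List.mem_range.mpr hdeg) t ht

end PolynomialLists

/-! ### Semidecidable predicates and unbounded search -/

section SemiDecidability

open Encodable

variable {α β σ : Type*} [Primcodable α] [Primcodable β] [Primcodable σ]

/-- A fold is a recursion on the number of entries consumed; within the length of the list the
lookup never fails. -/
theorem Computable.list_foldl {f : α → List β} {g : α → σ} {h : α → σ × β → σ}
    (hf : Computable f) (hg : Computable g) (hh : Computable₂ h) :
    Computable fun a => (f a).foldl (fun s b => h a (s, b)) (g a) := by
  have key : Computable fun a => Nat.rec (motive := fun _ => σ) (g a)
      (fun k s => Option.casesOn ((f a)[k]?) s fun b => h a (s, b)) (f a).length := by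
    refine Computable.nat_rec (Computable.list_length.comp hf) hg
      (h := fun a ks => Option.casesOn ((f a)[ks.1]?) ks.2 fun b => h a (ks.2, b)) ?_
    refine Computable.option_casesOn
      (Computable.list_getElem?.comp (hf.comp Computable.fst)
        (Computable.fst.comp Computable.snd)) (Computable.snd.comp Computable.snd) ?_
    exact hh.comp (Computable.fst.comp Computable.fst)
      (Computable.pair (Computable.snd.comp (Computable.snd.comp Computable.fst)) Computable.snd)
  refine key.of_eq fun a => ?_
  have : ∀ k ≤ (f a).length, Nat.rec (motive := fun _ => σ) (g a)
      (fun k s => Option.casesOn ((f a)[k]?) s fun b => h a (s, b)) k =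
        ((f a).take k).foldl (fun s b => h a (s, b)) (g a) := by
    intro k hk
    induction k with
    | zero => simp
    | succ k ih =>
      have hk' : k < (f a).length := hk
      rw [List.take_add_one, List.getElem?_eq_getElem hk']
      simp only [List.foldl_append, Option.toList_some, List.foldl_cons, List.foldl_nil,
        ← ih hk'.le]
      simp [List.getElem?_eq_getElem hk']
  rw [this _ le_rfl, List.take_length]

theorem Computable.list_foldr {f : α → List β} {g : α → σ} {h : α → β × σ → σ}
    (hf : Computable f) (hg : Computable g) (hh : Computable₂ h) :
    Computable fun a => (f a).foldr (fun b s => h a (b, s)) (g a) := by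
  refine (Computable.list_foldl (Computable.list_reverse.comp hf) hg
    (h := fun a sb => h a (sb.2, sb.1)) ?_).of_eq fun a => by rw [List.foldl_reverse]
  exact hh.comp Computable.fst ((Computable.snd.comp Computable.snd).pair
    (Computable.fst.comp Computable.snd))

/-- A predicate is semidecidable if it is the projection of a decidable one. -/
def SemiDec (p : α → Prop) : Prop :=
  ∃ c : α → ℕ → Bool, Computable₂ c ∧ ∀ a, p a ↔ ∃ n, c a n = true

namespace SemiDec

theorem of_iff {p q : α → Prop} (hp : SemiDec p) (h : ∀ a, q a ↔ p a) : SemiDec q := by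
  obtain ⟨c, hc, hpc⟩ := hp
  exact ⟨c, hc, fun a => (h a).trans (hpc a)⟩

theorem of_computable {f : α → Bool} (hf : Computable f) : SemiDec fun a => f a = true :=
  ⟨fun a _ => f a, hf.comp Computable.fst, fun _ => ⟨fun h => ⟨0, h⟩, fun ⟨_, h⟩ => h⟩⟩

theorem of_primrecRel {R : β → σ → Prop} (hR : PrimrecRel R) {f : α → β} {g : α → σ}
    (hf : Computable f) (hg : Computable g) : SemiDec fun a => R (f a) (g a) := by
  classical
  refine (of_computable (f := fun a => decide (R (f a) (g a)))
    (Computable₂.comp hR.decide.to_comp hf hg)).of_iff fun a => ?_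
  simp

theorem comp {p : β → Prop} (hp : SemiDec p) {f : α → β} (hf : Computable f) :
    SemiDec fun a => p (f a) := by
  obtain ⟨c, hc, hpc⟩ := hp
  exact ⟨fun a n => c (f a) n, hc.comp (hf.comp Computable.fst) Computable.snd, fun a => hpc _⟩

theorem and {p q : α → Prop} (hp : SemiDec p) (hq : SemiDec q) : SemiDec fun a => p a ∧ q a := by
  obtain ⟨c, hc, hpc⟩ := hp
  obtain ⟨d, hd, hqd⟩ := hq
  refine ⟨fun a n => c a n.unpair.1 && d a n.unpair.2, ?_, fun a => ?_⟩
  · exact Primrec.and.to_comp.comp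
      (hc.comp Computable.fst (Computable.fst.comp (Computable.unpair.comp Computable.snd)))
      (hd.comp Computable.fst (Computable.snd.comp (Computable.unpair.comp Computable.snd)))
  · simp only [hpc, hqd]
    constructor
    · rintro ⟨⟨m, hm⟩, n, hn⟩
      exact ⟨Nat.pair m n, by simp [hm, hn]⟩
    · rintro ⟨n, hn⟩
      rw [Bool.and_eq_true] at hn
      exact ⟨⟨_, hn.1⟩, _, hn.2⟩

/-- A candidate and a stage of its verification are packed into one natural number. -/
theorem ex {p : α × β → Prop} (hp : SemiDec p) : SemiDec fun a => ∃ b, p (a, b) := by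
  obtain ⟨c, hc, hpc⟩ := hp
  refine ⟨fun a n => Option.casesOn (decode (α := β) n.unpair.1) false
    fun b => c (a, b) n.unpair.2, ?_, fun a => ?_⟩
  · refine Computable.option_casesOn (Computable.decode.comp
      (Computable.fst.comp (Computable.unpair.comp Computable.snd))) (Computable.const false) ?_
    exact hc.comp ((Computable.fst.comp Computable.fst).pair Computable.snd)
      (Computable.snd.comp (Computable.unpair.comp (Computable.snd.comp Computable.fst)))
  · constructor
    · rintro ⟨b, hb⟩
      obtain ⟨n, hn⟩ := (hpc _).mp hb
      exact ⟨Nat.pair (encode b) n, by simpa using hn⟩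
    · rintro ⟨n, hn⟩
      cases hd : decode (α := β) n.unpair.1 with
      | none => simp [hd] at hn
      | some b => exact ⟨b, (hpc _).mpr ⟨n.unpair.2, by simpa [hd] using hn⟩⟩

/-- Makes acceptance monotone in the stage, so that finitely many verifications can share one stage.
-/
theorem exists_le_computable {c : α → ℕ → Bool} (hc : Computable₂ c) :
    ∃ d : α → ℕ → Bool, Computable₂ d ∧ ∀ a m, d a m = true ↔ ∃ n < m, c a n = true := by
  refine ⟨fun a m => Nat.rec (motive := fun _ => Bool) false (fun k acc => acc || c a k) m,
    ?_, fun a m => ?_⟩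
  · refine Computable.nat_rec (f := fun x : α × ℕ => x.2) Computable.snd (Computable.const false)
      (h := fun x ks => ks.2 || c x.1 ks.1) ?_
    exact Primrec.or.to_comp.comp (Computable.snd.comp Computable.snd)
      (hc.comp (Computable.fst.comp Computable.fst) (Computable.fst.comp Computable.snd))
  · induction m with
    | zero => simp
    | succ m ih =>
      simp only [Bool.or_eq_true, ih, Nat.lt_succ_iff_lt_or_eq]
      constructor
      · rintro (⟨n, hn, h⟩ | h)
        · exact ⟨n, Or.inl hn, h⟩
        · exact ⟨m, Or.inr rfl, h⟩
      · rintro ⟨n, hn | rfl, h⟩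
        · exact Or.inl ⟨n, hn, h⟩
        · exact Or.inr h

theorem ball {p : α × β → Prop} (hp : SemiDec p) {l : α → List β} (hl : Computable l) :
    SemiDec fun a => ∀ b ∈ l a, p (a, b) := by
  obtain ⟨c, hc, hpc⟩ := hp
  obtain ⟨d, hd, hdc⟩ := exists_le_computable hc
  refine ⟨fun a m => (l a).foldr (fun b s => d (a, b) m && s) true, ?_, fun a => ?_⟩
  · refine Computable.list_foldr (f := fun x : α × ℕ => l x.1) (hl.comp Computable.fst)
      (Computable.const true) (h := fun x bs => d (x.1, bs.1) x.2 && bs.2) ?_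
    exact Primrec.and.to_comp.comp
      (hd.comp ((Computable.fst.comp Computable.fst).pair (Computable.fst.comp Computable.snd))
        (Computable.snd.comp Computable.fst)) (Computable.snd.comp Computable.snd)
  · have hall : ∀ m, (l a).foldr (fun b s => d (a, b) m && s) true = true ↔
        ∀ b ∈ l a, d (a, b) m = true := by
      intro m
      induction l a with
      | nil => simp
      | cons b t ih => simp [ih]
    simp only [hall, hdc, hpc]
    constructor
    · intro h
      choose! n hn using h
      refine ⟨((l a).map n).sum + 1, fun b hb => ⟨n b, Nat.lt_succ_of_le ?_, hn b hb⟩⟩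
      exact List.single_le_sum (fun _ _ => Nat.zero_le _) _ (List.mem_map_of_mem hb)
    · rintro ⟨m, h⟩ b hb
      obtain ⟨n, -, hn⟩ := h b hb
      exact ⟨n, hn⟩

/-- Unbounded search for a witness of a semidecidable relation. -/
theorem exists_search {r : α → β → Prop} (hr : SemiDec fun x : α × β => r x.1 x.2) :
    ∃ f : α →. β, Partrec f ∧ (∀ a, ∀ b ∈ f a, r a b) ∧ ∀ a, (∃ b, r a b) → ∃ b, b ∈ f a := by
  obtain ⟨c, hc, hrc⟩ := hr
  set g : α → ℕ → Option β := fun a n => Option.casesOn (decode (α := β) n.unpair.1) none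
    fun b => bif c (a, b) n.unpair.2 then some b else none with hg
  have hgc : Computable₂ g := by
    refine Computable.option_casesOn (Computable.decode.comp
      (Computable.fst.comp (Computable.unpair.comp Computable.snd))) (Computable.const none) ?_
    refine Computable.cond (hc.comp ((Computable.fst.comp Computable.fst).pair Computable.snd)
      (Computable.snd.comp (Computable.unpair.comp (Computable.snd.comp Computable.fst))))
      (Computable.option_some.comp Computable.snd) (Computable.const none)
  refine ⟨fun a => Nat.rfindOpt (g a), Partrec.rfindOpt hgc, fun a b hb => ?_, fun a hab => ?_⟩
  · obtain ⟨n, hn⟩ := Nat.rfindOpt_spec hb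
    simp only [hg] at hn
    cases hd : decode (α := β) n.unpair.1 with
    | none => simp [hd] at hn
    | some b' =>
      cases hcb : c (a, b') n.unpair.2 with
      | false => simp [hd, hcb] at hn
      | true =>
        simp only [hd, hcb, cond_true, Option.mem_def, Option.some.injEq] at hn
        subst hn
        exact (hrc (a, b')).mpr ⟨_, hcb⟩
  · obtain ⟨b, hb⟩ := hab
    obtain ⟨n, hn⟩ := (hrc (a, b)).mp hb
    refine Part.dom_iff_mem.mp (Nat.rfindOpt_dom.mpr ⟨Nat.pair (encode b) n, b, ?_⟩)
    simp [hg, hn]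

end SemiDec

end SemiDecidability

/-! ### Computability in a numbered field -/

section Presentation

open Polynomial

variable {α β K : Type*} [Primcodable α] [Primcodable β]

/-- A function to `K` is computable if it is so on the codes of the numbering `ν`. -/
def ComputableInto (ν : ℕ ≃ K) (f : α → K) : Prop :=
  Computable fun a => ν.symm (f a)

namespace ComputableInto

variable {ν : ℕ ≃ K}

theorem of_code {f : α → ℕ} (hf : Computable f) : ComputableInto ν fun a => ν (f a) :=
  hf.of_eq fun a => by simp

theorem const (x : K) : ComputableInto ν fun _ : α => x :=
  Computable.const _

theorem comp {f : β → K} (hf : ComputableInto ν f) {g : α → β} (hg : Computable g) :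
    ComputableInto ν fun a => f (g a) :=
  Computable.comp (f := fun b => ν.symm (f b)) hf hg

theorem semiDec_eq {f g : α → K} (hf : ComputableInto ν f) (hg : ComputableInto ν g) :
    SemiDec fun a => f a = g a :=
  (SemiDec.of_primrecRel Primrec.eq hf hg).of_iff fun a => by simp

theorem semiDec_ne {f g : α → K} (hf : ComputableInto ν f) (hg : ComputableInto ν g) :
    SemiDec fun a => f a ≠ g a :=
  (SemiDec.of_primrecRel Primrec.eq.not hf hg).of_iff fun a => by simp

end ComputableInto

variable [Field K]

/-- A numbering with computable addition and multiplication. -/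
def IsComputableNumbering (ν : ℕ ≃ K) : Prop :=
  (Computable₂ fun m n : ℕ => ν.symm (ν m + ν n)) ∧ Computable₂ fun m n : ℕ => ν.symm (ν m * ν n)

namespace ComputableInto

variable {ν : ℕ ≃ K}

theorem add (hν : IsComputableNumbering ν) {f g : α → K} (hf : ComputableInto ν f)
    (hg : ComputableInto ν g) : ComputableInto ν fun a => f a + g a :=
  (Computable₂.comp hν.1 hf hg).of_eq fun a => by simp

theorem mul (hν : IsComputableNumbering ν) {f g : α → K} (hf : ComputableInto ν f)
    (hg : ComputableInto ν g) : ComputableInto ν fun a => f a * g a :=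
  (Computable₂.comp hν.2 hf hg).of_eq fun a => by simp

/-- Negation is multiplication by the fixed code of -1. -/
theorem sub (hν : IsComputableNumbering ν) {f g : α → K} (hf : ComputableInto ν f)
    (hg : ComputableInto ν g) : ComputableInto ν fun a => f a - g a :=
  (add hν hf (mul hν (const (-1)) hg)).of_eq fun a => by ring_nf

theorem natCast (hν : IsComputableNumbering ν) {f : α → ℕ} (hf : Computable f) :
    ComputableInto ν fun a => (f a : K) := by
  refine (Computable.nat_rec hf (Computable.const (ν.symm 0))
    (h := fun _ ks => ν.symm (ν ks.2 + 1)) ?_).of_eq fun a => ?_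
  · exact add hν (of_code (Computable.snd.comp Computable.snd)) (const 1)
  · beta_reduce
    induction f a with
    | zero => simp
    | succ n ih => simp [ih]

theorem pow (hν : IsComputableNumbering ν) {f : α → K} (hf : ComputableInto ν f) {g : α → ℕ}
    (hg : Computable g) : ComputableInto ν fun a => f a ^ g a := by
  refine (Computable.nat_rec hg (Computable.const (ν.symm 1))
    (h := fun a ks => ν.symm (ν ks.2 * f a)) ?_).of_eq fun a => ?_
  · exact mul hν (of_code (Computable.snd.comp Computable.snd)) (hf.comp Computable.fst)
  · beta_reduce
    induction g a with
    | zero => simp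
    | succ n ih => simp [ih, pow_succ]

theorem aeval_polyOfList (hν : IsComputableNumbering ν) {f : α → K} (hf : ComputableInto ν f)
    {l : α → List (ℕ × ℕ)} (hl : Computable l) :
    ComputableInto ν fun a => aeval (f a) (polyOfList (l a)) := by
  refine (Computable.list_foldr hl (Computable.const (ν.symm 0))
    (h := fun a ws => ν.symm ((ws.1.1 : K) - (ws.1.2 : K) + f a * ν ws.2)) ?_).of_eq fun a => ?_
  · refine add hν (sub hν (natCast hν ?_) (natCast hν ?_)) (mul hν (hf.comp Computable.fst)
      (of_code (Computable.snd.comp Computable.snd)))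
    · exact Computable.fst.comp (Computable.fst.comp Computable.snd)
    · exact Computable.snd.comp (Computable.fst.comp Computable.snd)
  · beta_reduce
    induction l a with
    | nil => simp
    | cons w l ih => simp [ih]

theorem aeval_monicOfList (hν : IsComputableNumbering ν) {f : α → K} (hf : ComputableInto ν f)
    {l : α → List (ℕ × ℕ)} (hl : Computable l) :
    ComputableInto ν fun a => aeval (f a) (monicOfList (l a)) :=
  (add hν (pow hν hf (Computable.list_length.comp hl)) (aeval_polyOfList hν hf hl)).of_eq
    fun a => by simp [monicOfList]

end ComputableInto

namespace SemiDec

theorem dvd {f g : α → ℕ} (hf : Computable f) (hg : Computable g) :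
    SemiDec fun a => f a ∣ g a :=
  (of_primrecRel Primrec.eq (Primrec.nat_mod.to_comp.comp hg hf) (Computable.const 0)).of_iff
    fun _ => Nat.dvd_iff_mod_eq_zero

theorem not_dvd {f g : α → ℕ} (hf : Computable f) (hg : Computable g) :
    SemiDec fun a => ¬ f a ∣ g a :=
  (of_primrecRel Primrec.eq.not (Primrec.nat_mod.to_comp.comp hg hf) (Computable.const 0)).of_iff
    fun _ => not_congr Nat.dvd_iff_mod_eq_zero

theorem ne_zero {f : α → ℕ} (hf : Computable f) : SemiDec fun a => f a ≠ 0 :=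
  of_primrecRel Primrec.eq.not hf (Computable.const 0)

theorem prime : SemiDec Nat.Prime := by
  have h1 : SemiDec fun p : ℕ => 2 ≤ p :=
    of_primrecRel Primrec.nat_le (Computable.const 2) Computable.id
  have h2 : SemiDec fun p : ℕ => ∀ m ∈ List.range (p - 2), ¬ (m + 2) ∣ p := by
    refine ball (p := fun x : ℕ × ℕ => ¬ (x.2 + 2) ∣ x.1) (not_dvd ?_ Computable.fst) ?_
    · exact Primrec.nat_add.to_comp.comp Computable.snd (Computable.const 2)
    · exact Primrec.list_range.to_comp.comp
        (Primrec.nat_sub.to_comp.comp Computable.id (Computable.const 2))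
  refine (h1.and h2).of_iff fun p => ?_
  rw [Nat.prime_def_lt']
  refine and_congr_right fun _ => ⟨fun h m hm => ?_, fun h m hm hmp => ?_⟩
  · exact h _ (by omega) (by have := List.mem_range.mp hm; omega)
  · obtain ⟨k, rfl⟩ := Nat.exists_eq_add_of_le' hm
    exact h k (List.mem_range.mpr (by omega))

end SemiDec

theorem Primrec.nat_pow : Primrec₂ ((· ^ ·) : ℕ → ℕ → ℕ) :=
  Primrec₂.unpaired'.1 Nat.Primrec.pow

theorem Primrec.boxLists : Primrec₂ boxLists := by
  have hr : Primrec fun M : ℕ => List.range (M + 1) := Primrec.list_range.comp Primrec.succ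
  refine Primrec.nat_rec (f := fun _ : ℕ => [[]]) (Primrec.const _)
    (g := fun M kB => kB.2.flatMap fun t => (List.range (M + 1)).flatMap fun u =>
      (List.range (M + 1)).map fun v => (u, v) :: t) ?_
  refine Primrec.list_flatMap (Primrec.snd.comp Primrec.snd) ?_
  refine Primrec.list_flatMap (hr.comp (Primrec.fst.comp Primrec.fst)) ?_
  refine Primrec.list_map (hr.comp (Primrec.fst.comp (Primrec.fst.comp Primrec.fst))) ?_
  exact Primrec.list_cons.comp ((Primrec.snd.comp Primrec.fst).pair Primrec.snd)
    (Primrec.snd.comp (Primrec.fst.comp Primrec.fst))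

variable {ν : ℕ ≃ K}

theorem semiDec_isIntegral (hν : IsComputableNumbering ν) {f : α → K} (hf : ComputableInto ν f) :
    SemiDec fun a => IsIntegral ℤ (f a) :=
  (SemiDec.ex (p := fun x : α × List (ℕ × ℕ) => aeval (f x.1) (monicOfList x.2) = 0)
    (((hf.comp Computable.fst).aeval_monicOfList hν Computable.snd).semiDec_eq
      (ComputableInto.const 0))).of_iff fun _ => isIntegral_int_iff_exists_list

/-- Once T and M are guessed, the certificate is a finite list of equations and inequations in K,
decidable on codes since the numbering has no repetitions. -/
theorem semiDec_minpoly [CharZero K] (hν : IsComputableNumbering ν) {f : α → K}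
    (hf : ComputableInto ν f) {l : α → List (ℕ × ℕ)} (hl : Computable l) :
    SemiDec fun a => IsIntegral ℤ (f a) ∧ minpoly ℤ (f a) = monicOfList (l a) := by
  refine SemiDec.of_iff ?_ fun a => isIntegral_and_minpoly_int_eq_iff
  refine ((hf.aeval_monicOfList hν hl).semiDec_eq (ComputableInto.const 0)).and ?_
  refine SemiDec.ex (p := fun x : α × ℕ => ∃ M : ℕ, (∀ w ∈ l x.1, w.1 + w.2 < x.2) ∧
    ((x.2 + 1) * 2) ^ (l x.1).length ≤ M ∧ ∀ k ∈ List.range (l x.1).length,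
      ∀ t ∈ boxLists M k, aeval (f x.1) (monicOfList t) ≠ 0) ?_
  refine SemiDec.ex (p := fun x : (α × ℕ) × ℕ => (∀ w ∈ l x.1.1, w.1 + w.2 < x.1.2) ∧
    ((x.1.2 + 1) * 2) ^ (l x.1.1).length ≤ x.2 ∧ ∀ k ∈ List.range (l x.1.1).length,
      ∀ t ∈ boxLists x.2 k, aeval (f x.1.1) (monicOfList t) ≠ 0) ?_
  have hlx : Computable fun x : (α × ℕ) × ℕ => l x.1.1 :=
    hl.comp (Computable.fst.comp Computable.fst)
  have hlen := Computable.list_length.comp hlx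
  refine SemiDec.and ?_ (SemiDec.and ?_ ?_)
  · refine SemiDec.ball (p := fun y : ((α × ℕ) × ℕ) × ℕ × ℕ => y.2.1 + y.2.2 < y.1.1.2) ?_ hlx
    exact SemiDec.of_primrecRel Primrec.nat_lt
      (Primrec.nat_add.to_comp.comp (Computable.fst.comp Computable.snd)
        (Computable.snd.comp Computable.snd))
      (Computable.snd.comp (Computable.fst.comp Computable.fst))
  · refine SemiDec.of_primrecRel Primrec.nat_le (Primrec.nat_pow.to_comp.comp ?_ hlen) Computable.snd
    exact Primrec.nat_mul.to_comp.comp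
      (Computable.succ.comp (Computable.snd.comp Computable.fst)) (Computable.const 2)
  · refine SemiDec.ball (p := fun y : ((α × ℕ) × ℕ) × ℕ => ∀ t ∈ boxLists y.1.2 y.2,
      aeval (f y.1.1.1) (monicOfList t) ≠ 0) ?_ (Primrec.list_range.to_comp.comp hlen)
    refine SemiDec.ball (p := fun z : (((α × ℕ) × ℕ) × ℕ) × List (ℕ × ℕ) =>
      aeval (f z.1.1.1.1) (monicOfList z.2) ≠ 0) ?_ (Primrec.boxLists.to_comp.comp
        (Computable.snd.comp Computable.fst) Computable.snd)
    exact ((hf.comp (Computable.fst.comp (Computable.fst.comp (Computable.fst.comp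
      Computable.fst)))).aeval_monicOfList hν Computable.snd).semiDec_ne (ComputableInto.const 0)

theorem semiDec_unramifiedCert (hν : IsComputableNumbering ν) {g : α → K}
    (hg : ComputableInto ν g) {p : α → ℕ} (hp : Computable p) :
    SemiDec fun a => UnramifiedCert (g a) (p a) := by
  refine SemiDec.of_iff (p := fun a => ∃ e m : ℕ, ∃ l : List (ℕ × ℕ), e ≠ 0 ∧
    IsIntegral ℤ ((e : K) * g a) ∧ m ≠ 0 ∧
    ((e : K) * g a) ^ p a ^ m = e * g a + p a * aeval ((e : K) * g a) (polyOfList l)) ?_ fun a => ?_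
  · refine SemiDec.ex (p := fun x : α × ℕ => ∃ m : ℕ, ∃ l : List (ℕ × ℕ), x.2 ≠ 0 ∧
      IsIntegral ℤ ((x.2 : K) * g x.1) ∧ m ≠ 0 ∧ ((x.2 : K) * g x.1) ^ p x.1 ^ m =
        x.2 * g x.1 + p x.1 * aeval ((x.2 : K) * g x.1) (polyOfList l)) ?_
    refine SemiDec.ex (p := fun x : (α × ℕ) × ℕ => ∃ l : List (ℕ × ℕ), x.1.2 ≠ 0 ∧
      IsIntegral ℤ ((x.1.2 : K) * g x.1.1) ∧ x.2 ≠ 0 ∧ ((x.1.2 : K) * g x.1.1) ^ p x.1.1 ^ x.2 =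
        x.1.2 * g x.1.1 + p x.1.1 * aeval ((x.1.2 : K) * g x.1.1) (polyOfList l)) ?_
    refine SemiDec.ex (p := fun x : ((α × ℕ) × ℕ) × List (ℕ × ℕ) => x.1.1.2 ≠ 0 ∧
      IsIntegral ℤ ((x.1.1.2 : K) * g x.1.1.1) ∧ x.1.2 ≠ 0 ∧
      ((x.1.1.2 : K) * g x.1.1.1) ^ p x.1.1.1 ^ x.1.2 = x.1.1.2 * g x.1.1.1 +
        p x.1.1.1 * aeval ((x.1.1.2 : K) * g x.1.1.1) (polyOfList x.2)) ?_
    have ha : Computable fun x : ((α × ℕ) × ℕ) × List (ℕ × ℕ) => x.1.1.1 :=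
      Computable.fst.comp (Computable.fst.comp Computable.fst)
    have he : Computable fun x : ((α × ℕ) × ℕ) × List (ℕ × ℕ) => x.1.1.2 :=
      Computable.snd.comp (Computable.fst.comp Computable.fst)
    have hm : Computable fun x : ((α × ℕ) × ℕ) × List (ℕ × ℕ) => x.1.2 :=
      Computable.snd.comp Computable.fst
    have hpx := hp.comp ha
    have heg := (ComputableInto.natCast hν he).mul hν (hg.comp ha)
    refine (SemiDec.ne_zero he).and ((semiDec_isIntegral hν heg).and
      ((SemiDec.ne_zero hm).and ?_))
    refine (heg.pow hν (Primrec.nat_pow.to_comp.comp hpx hm)).semiDec_eq ?_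
    exact heg.add hν ((ComputableInto.natCast hν hpx).mul hν
      (heg.aeval_polyOfList hν Computable.snd))
  · constructor
    · rintro ⟨e, he, hint, m, hm, h, hh⟩
      obtain ⟨l, rfl⟩ := polyOfList_surjective h
      exact ⟨e, m, l, he, hint, hm, hh⟩
    · rintro ⟨e, m, l, he, hint, hm, hh⟩
      exact ⟨e, he, hint, m, hm, _, hh⟩

/-- The value is computed inside K, where ℤ embeds; comparing squares removes the sign. -/
theorem semiDec_natAbs_eval [CharZero K] (hν : IsComputableNumbering ν) {l : α → List (ℕ × ℕ)}
    (hl : Computable l) {c q n : α → ℕ} (hc : Computable c) (hq : Computable q)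
    (hn : Computable n) :
    SemiDec fun a => ((monicOfList (l a)).eval (-(c a * q a : ℤ))).natAbs = n a := by
  have hx : ComputableInto ν fun a => (0 : K) - c a * q a :=
    (ComputableInto.const 0).sub hν
      ((ComputableInto.natCast hν hc).mul hν (ComputableInto.natCast hν hq))
  have hv := hx.aeval_monicOfList hν hl
  have hnK := ComputableInto.natCast hν hn
  refine ((hv.mul hν hv).semiDec_eq (hnK.mul hν hnK)).of_iff fun a => ?_
  have h1 : aeval ((0 : K) - c a * q a) (monicOfList (l a)) =
      (((monicOfList (l a)).eval (-(c a * q a : ℤ)) : ℤ) : K) := by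
    have : (0 : K) - c a * q a = ((-(c a * q a : ℤ) : ℤ) : K) := by push_cast; ring
    rw [this, ← eq_intCast (algebraMap ℤ K), aeval_algebraMap_apply_eq_algebraMap_eval, eq_intCast]
  rw [h1, ← Int.cast_natCast (n a), ← Int.cast_mul, ← Int.cast_mul, Int.cast_inj]
  refine ⟨fun h => by rw [← h, Int.natAbs_mul_self'], fun h => ?_⟩
  have h2 := congrArg Int.natAbs h
  rw [Int.natAbs_mul, Int.natAbs_mul, Int.natAbs_natCast] at h2
  exact Nat.mul_self_inj.mp h2

theorem semiDec_sqrtStep [CharZero K] (hν : IsComputableNumbering ν) :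
    SemiDec fun x : (List (ℕ × ℕ) × ℕ × List ℕ × ℕ × ℕ × ℕ) × (ℕ × ℕ × ℕ) =>
      SqrtStep (monicOfList x.1.1) x.1.2.1 (x.1.2.2.1.map ν) x.1.2.2.2 x.2.1 x.2.2.1 x.2.2.2 := by
  have hq : Computable fun x : (List (ℕ × ℕ) × ℕ × List ℕ × ℕ × ℕ × ℕ) × (ℕ × ℕ × ℕ) => x.2.1 :=
    Computable.fst.comp Computable.snd
  have hp : Computable fun x : (List (ℕ × ℕ) × ℕ × List ℕ × ℕ × ℕ × ℕ) × (ℕ × ℕ × ℕ) => x.2.2.1 :=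
    Computable.fst.comp (Computable.snd.comp Computable.snd)
  have hn : Computable fun x : (List (ℕ × ℕ) × ℕ × List ℕ × ℕ × ℕ × ℕ) × (ℕ × ℕ × ℕ) => x.2.2.2 :=
    Computable.snd.comp (Computable.snd.comp Computable.snd)
  have hl : Computable fun x : (List (ℕ × ℕ) × ℕ × List ℕ × ℕ × ℕ × ℕ) × (ℕ × ℕ × ℕ) => x.1.1 :=
    Computable.fst.comp Computable.fst
  have hcr := Computable.snd.comp (Computable.fst :
    Computable (@Prod.fst (List (ℕ × ℕ) × ℕ × List ℕ × ℕ × ℕ × ℕ) (ℕ × ℕ × ℕ)))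
  have hc := Computable.fst.comp hcr
  have hGr := Computable.snd.comp hcr
  have hG := Computable.fst.comp hGr
  have hs := Computable.snd.comp hGr
  refine SemiDec.and (SemiDec.of_primrecRel Primrec.nat_lt (Computable.fst.comp hs) hq) ?_
  refine SemiDec.and (SemiDec.dvd (Computable.fst.comp (Computable.snd.comp hs)) hq) ?_
  refine SemiDec.and (SemiDec.prime.comp hp) ?_
  refine SemiDec.and (SemiDec.not_dvd hp (Computable.snd.comp (Computable.snd.comp hs))) ?_
  refine SemiDec.and (semiDec_natAbs_eval hν hl hc hq hn) ?_
  refine SemiDec.and (SemiDec.dvd hp hn) ?_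
  refine SemiDec.and (SemiDec.not_dvd (Primrec.nat_mul.to_comp.comp hp hp) hn) ?_
  refine SemiDec.of_iff (SemiDec.ball (p := fun y : ((List (ℕ × ℕ) × ℕ × List ℕ × ℕ × ℕ × ℕ) ×
    (ℕ × ℕ × ℕ)) × ℕ => UnramifiedCert (ν y.2) y.1.2.2.1) ?_ hG) fun x => ?_
  · exact semiDec_unramifiedCert hν (ComputableInto.of_code Computable.snd)
      (hp.comp Computable.fst)
  · simp

end Presentation

/-! ### The uniform decision procedure -/

section Decision

open Polynomial

/-- The state after choosing `q` with prime `p` and value `n`. -/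
def nextState (s t : ℕ × ℕ × ℕ) : ℕ × ℕ × ℕ :=
  (t.1, s.2.1 * t.2.1, s.2.2 * t.2.2)

/-- The relation T stands for the rule selecting a step. Taking the graph of the computable search
makes the run the very one the procedure computes. -/
theorem exists_isSqrtRun {f : ℤ[X]} {c : ℕ} {gens : List Qbar} (hc : c ≠ 0)
    (hf0 : f.eval 0 ≠ 0) {T : ℕ × ℕ × ℕ → ℕ × ℕ × ℕ → Prop}
    (hT : ∀ s t, T s t → SqrtStep f c gens s t.1 t.2.1 t.2.2)
    (hex : ∀ s : ℕ × ℕ × ℕ, s.2.1 ≠ 0 → s.2.2 ≠ 0 → ∃ t, T s t) :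
    ∃ s, IsSqrtRun f c gens s ∧ ∀ k, ∃ t, T (s k) t ∧ s (k + 1) = nextState (s k) t := by
  choose! next hnext using hex
  set s : ℕ → ℕ × ℕ × ℕ := fun k => Nat.rec (0, 1, c * (f.eval 0).natAbs)
    (fun _ st => nextState st (next st)) k with hs
  have hs1 : ∀ k, s (k + 1) = nextState (s k) (next (s k)) := fun k => rfl
  have hne : ∀ k, (s k).2.1 ≠ 0 ∧ (s k).2.2 ≠ 0 := by
    intro k
    induction k with
    | zero => exact ⟨one_ne_zero, mul_ne_zero hc (Int.natAbs_ne_zero.mpr hf0)⟩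
    | succ k ih =>
      -- The new value is nonzero because p² does not divide it.
      obtain ⟨_, _, hp, _, _, _, hn, _⟩ := hT _ _ (hnext _ ih.1 ih.2)
      rw [hs1]
      refine ⟨mul_ne_zero ih.1 hp.ne_zero, mul_ne_zero ih.2 fun h0 => ?_⟩
      rw [h0] at hn
      exact hn (dvd_zero _)
  have hstep : ∀ k, T (s k) (next (s k)) := fun k => hnext _ (hne k).1 (hne k).2
  exact ⟨s, ⟨rfl, fun k => ⟨_, _, _, hT _ _ (hstep k), hs1 k⟩⟩, fun k => ⟨_, hstep k, hs1 k⟩⟩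

theorem eval_zero_minpoly_int_ne_zero {K : Type*} [Field K] [CharZero K] {x : K}
    (hx : IsIntegral ℤ x) (h0 : x ≠ 0) : (minpoly ℤ x).eval 0 ≠ 0 := by
  intro h
  have hQ := minpoly.coeff_zero_ne_zero (A := ℚ) hx.tower_top h0
  rw [minpoly.isIntegrallyClosed_eq_field_fractions' ℚ hx, coeff_map, coeff_zero_eq_eval_zero, h,
    map_zero] at hQ
  exact hQ rfl

theorem exists_sqrtStep_minpoly {K : Type*} [Field K] [CharZero K] [Algebra.IsAlgebraic ℚ K]
    {x : K} (hx : IsIntegral ℤ x) (h0 : x ≠ 0) {c : ℕ} (hc : c ≠ 0) (gens : List K)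
    {s : ℕ × ℕ × ℕ} (hs1 : s.2.1 ≠ 0) (hs2 : s.2.2 ≠ 0) :
    ∃ t : ℕ × ℕ × ℕ, SqrtStep (minpoly ℤ x) c gens s t.1 t.2.1 t.2.2 := by
  obtain ⟨q, p, n, h⟩ := exists_sqrtStep (eval_zero_minpoly_int_ne_zero hx h0)
    (minpoly.natDegree_pos hx).ne' (separable_minpoly_int hx) hc gens hs1 hs2
  exact ⟨(q, p, n), h⟩

theorem exists_infinite_distinguishes {a b : Qbar} (hconj : IsConjRoot ℚ a b) (hab : a ≠ b)
    {gens : List Qbar} {E : IntermediateField ℚ Qbar}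
    (hE : E = IntermediateField.adjoin ℚ {x | x ∈ gens}) (haE : a ∈ E) (hbE : b ∈ E) :
    ∃ D : Set ℚ, D.Infinite ∧ Distinguishes E a b D := by
  -- Zero is its own only conjugate; a ≠ 0 is what makes f(0) nonzero.
  have ha0 : a ≠ 0 := by
    rintro rfl
    exact hab hconj.eq_zero.symm
  obtain ⟨c, hc, hA⟩ := exists_natCast_mul_isIntegral a
  have hA0 : (c : Qbar) * a ≠ 0 := mul_ne_zero (by exact_mod_cast hc) ha0
  obtain ⟨s, hs, -⟩ := exists_isSqrtRun (gens := gens) hc (eval_zero_minpoly_int_ne_zero hA hA0)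
    (T := fun s t => SqrtStep _ c gens s t.1 t.2.1 t.2.2) (fun _ _ h => h)
    (fun s h1 h2 => exists_sqrtStep_minpoly hA hA0 hc gens h1 h2)
  exact ⟨_, hs.infinite, hs.distinguishes hconj hab hE haE hbE hc hA⟩

/-- Iterating a partial step function for `k` steps, recording whether `target` occurs. -/
def runFor {A : Type*} (step : A × (ℕ × ℕ × ℕ) →. ℕ × ℕ × ℕ) (a : A) (init : ℕ × ℕ × ℕ)
    (target k : ℕ) : Part (Bool × (ℕ × ℕ × ℕ)) :=
  Nat.rec (Part.some (false, init)) (fun _ IH => IH.bind fun st =>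
    (step (a, st.2)).map fun t => (st.1 || t.1 == target, nextState st.2 t)) k

theorem Computable.nextState : Computable₂ nextState := by
  have h : Primrec₂ _root_.nextState := by
    refine Primrec.pair (Primrec.fst.comp Primrec.snd) (Primrec.pair ?_ ?_)
    · exact Primrec.nat_mul.comp (Primrec.fst.comp (Primrec.snd.comp Primrec.fst))
        (Primrec.fst.comp (Primrec.snd.comp Primrec.snd))
    · exact Primrec.nat_mul.comp (Primrec.snd.comp (Primrec.snd.comp Primrec.fst))
        (Primrec.snd.comp (Primrec.snd.comp Primrec.snd))
  exact h.to_comp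

theorem Partrec.runFor {A B : Type*} [Primcodable A] [Primcodable B]
    {step : A × (ℕ × ℕ × ℕ) →. ℕ × ℕ × ℕ} (hstep : Partrec step) {a : B → A}
    {init : B → ℕ × ℕ × ℕ} {target k : B → ℕ} (ha : Computable a) (hinit : Computable init)
    (htarget : Computable target) (hk : Computable k) :
    Partrec fun b => runFor step (a b) (init b) (target b) (k b) := by
  refine Partrec.nat_rec (g := fun b => Part.some (false, init b)) hk
    ((Computable.const false).pair hinit).partrec
    (h := fun b x => (step (a b, x.2.2)).map fun t =>
      (x.2.1 || t.1 == target b, nextState x.2.2 t)) ?_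
  refine Partrec.map (hstep.comp ((ha.comp Computable.fst).pair
    (Computable.snd.comp (Computable.snd.comp Computable.snd)))) ?_
  refine Computable.pair ?_ ?_
  · refine Primrec.or.to_comp.comp
      (Computable.fst.comp (Computable.snd.comp (Computable.snd.comp Computable.fst))) ?_
    exact Primrec.beq.to_comp.comp (Computable.fst.comp Computable.snd)
      (htarget.comp (Computable.fst.comp Computable.fst))
  · exact Computable.nextState.comp
      (Computable.snd.comp (Computable.snd.comp (Computable.snd.comp Computable.fst)))
      Computable.snd

theorem exists_mem_runFor {A : Type*} {step : A × (ℕ × ℕ × ℕ) →. ℕ × ℕ × ℕ} {a : A}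
    {s : ℕ → ℕ × ℕ × ℕ} (hs : ∀ k, ∃ t ∈ step (a, s k), s (k + 1) = nextState (s k) t)
    (target k : ℕ) :
    (decide (∃ l < k, (s (l + 1)).1 = target), s k) ∈ runFor step a (s 0) target k := by
  induction k with
  | zero => simp [runFor]
  | succ k ih =>
    obtain ⟨t, ht, hst⟩ := hs k
    have h1 : t.1 = (s (k + 1)).1 := by rw [hst]; rfl
    refine Part.mem_bind_iff.mpr ⟨_, ih, (Part.mem_map_iff _).mpr ⟨t, ht, ?_⟩⟩
    rw [hst]
    refine Prod.ext ?_ rfl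
    rw [Bool.eq_iff_iff]
    simp only [Bool.or_eq_true, decide_eq_true_eq, beq_iff_eq, h1, Nat.lt_succ_iff_lt_or_eq]
    constructor
    · rintro (⟨l, hl, h⟩ | h)
      · exact ⟨l, Or.inl hl, h⟩
      · exact ⟨k, Or.inr rfl, h⟩
    · rintro ⟨l, hl | rfl, h⟩
      · exact Or.inl ⟨l, hl, h⟩
      · exact Or.inr h

/-- Membership of a rational number in a strictly increasing sequence of naturals is settled by
the first terms. -/
theorem mem_run_iff {u : ℕ → ℕ} (hu : StrictMono u) (q : ℚ) :
    (∃ k, q = (u (k + 1) : ℚ)) ↔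
      ((∃ l < (Encodable.encode q.num).div2 + 1, u (l + 1) = (Encodable.encode q.num).div2) ∧
        (Encodable.encode q.num).bodd = false) ∧ q.den = 1 := by
  -- Integers are encoded as 2n for n and 2n + 1 for -(n + 1), so parity tests the sign and halving
  -- recovers a natural number.
  have henc : ∀ n : ℕ, Encodable.encode (n : ℤ) = 2 * n := fun n => rfl
  constructor
  · rintro ⟨k, rfl⟩
    rw [Rat.num_natCast, Rat.den_natCast, henc]
    refine ⟨⟨⟨k, ?_, ?_⟩, by simp⟩, rfl⟩
    · have := hu.id_le (k + 1)
      simp only [id, Nat.div2_val] at *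
      omega
    · simp
  · rintro ⟨⟨⟨l, -, hl⟩, hodd⟩, hden⟩
    refine ⟨l, ?_⟩
    have hnum : q.num = ((Encodable.encode q.num).div2 : ℤ) := by
      generalize q.num = z at hodd ⊢
      cases z with
      | ofNat n => rw [Int.ofNat_eq_natCast, henc]; simp
      | negSucc n =>
        have : Encodable.encode (Int.negSucc n) = 2 * n + 1 := rfl
        rw [this] at hodd
        simp at hodd
    rw [hl]
    conv_lhs => rw [← Rat.num_div_den q, hden, hnum]
    simp

/-- Two searches suffice: one for c, the minimal polynomial of ca and |f(0)|, and one repeated for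
each step of the run. -/
theorem exists_decision {ν : ℕ ≃ Qbar} (hν : IsComputableNumbering ν) :
    ∃ dec : List ℕ × ℕ × ℕ × List ℕ × ℤ × ℕ →. Bool, Partrec dec ∧
      ∀ (L : List ℕ) (i j : ℕ) (a b : Qbar), L.getD i 0 = ν.symm a → IsConjRoot ℚ a b → a ≠ b →
      ∀ (gens : List Qbar) (E : IntermediateField ℚ Qbar),
        E = IntermediateField.adjoin ℚ {x | x ∈ gens} → a ∈ E → b ∈ E →
        ∃ D : Set ℚ, D.Infinite ∧ Distinguishes E a b D ∧ ∀ q : ℚ,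
          (q ∈ D → true ∈ dec (L, i, j, gens.map ν.symm, q.num, q.den)) ∧
          (q ∉ D → false ∈ dec (L, i, j, gens.map ν.symm, q.num, q.den)) := by
  classical
  obtain ⟨find, hfind, hfind_sound, hfind_ex⟩ := SemiDec.exists_search
    (r := fun (x : ℕ) (y : ℕ × List (ℕ × ℕ) × ℕ) => y.1 ≠ 0 ∧
      (IsIntegral ℤ ((y.1 : Qbar) * ν x) ∧
        minpoly ℤ ((y.1 : Qbar) * ν x) = monicOfList y.2.1) ∧
      ((monicOfList y.2.1).eval (-(y.1 * (0 : ℕ) : ℤ))).natAbs = y.2.2) (by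
    have hc : Computable fun x : ℕ × (ℕ × List (ℕ × ℕ) × ℕ) => x.2.1 :=
      Computable.fst.comp Computable.snd
    have hl : Computable fun x : ℕ × (ℕ × List (ℕ × ℕ) × ℕ) => x.2.2.1 :=
      Computable.fst.comp (Computable.snd.comp Computable.snd)
    have hn : Computable fun x : ℕ × (ℕ × List (ℕ × ℕ) × ℕ) => x.2.2.2 :=
      Computable.snd.comp (Computable.snd.comp Computable.snd)
    exact (SemiDec.ne_zero hc).and ((semiDec_minpoly hν ((ComputableInto.natCast hν hc).mul hν
      (ComputableInto.of_code Computable.fst)) hl).and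
      (semiDec_natAbs_eval hν hl hc (Computable.const 0) hn)))
  obtain ⟨step, hstep, hstep_sound, hstep_ex⟩ := SemiDec.exists_search
    (r := fun (x : (List (ℕ × ℕ) × ℕ × List ℕ) × ℕ × ℕ × ℕ) (t : ℕ × ℕ × ℕ) =>
      SqrtStep (monicOfList x.1.1) x.1.2.1 (x.1.2.2.map ν) x.2 t.1 t.2.1 t.2.2) (by
    refine (semiDec_sqrtStep hν).comp (f := fun x : ((List (ℕ × ℕ) × ℕ × List ℕ) × ℕ × ℕ × ℕ) ×
      ℕ × ℕ × ℕ => ((x.1.1.1, x.1.1.2.1, x.1.1.2.2, x.1.2), x.2)) ?_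
    have h := Computable.fst.comp (Computable.fst (α := (List (ℕ × ℕ) × ℕ × List ℕ) × ℕ × ℕ × ℕ)
      (β := ℕ × ℕ × ℕ))
    exact Computable.pair ((Computable.fst.comp h).pair ((Computable.fst.comp
      (Computable.snd.comp h)).pair ((Computable.snd.comp (Computable.snd.comp h)).pair
        (Computable.snd.comp Computable.fst)))) Computable.snd)
  -- With y = (c, coefficients, |f(0)|), run one step more than the candidate's size, then require a
  -- hit, a nonnegative numerator and denominator 1.
  refine ⟨fun x => (find (x.1.getD x.2.1 0)).bind fun y =>
    (runFor step (y.2.1, y.1, x.2.2.2.1) (0, 1, y.1 * y.2.2)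
      (Encodable.encode x.2.2.2.2.1).div2 ((Encodable.encode x.2.2.2.2.1).div2 + 1)).map fun st =>
        (st.1 && !(Encodable.encode x.2.2.2.2.1).bodd) && x.2.2.2.2.2 == 1, ?_, ?_⟩
  · have hy : Computable fun z : (List ℕ × ℕ × ℕ × List ℕ × ℤ × ℕ) × (ℕ × List (ℕ × ℕ) × ℕ) => z.2 :=
      Computable.snd
    have hx1 : Computable fun x : List ℕ × ℕ × ℕ × List ℕ × ℤ × ℕ => x.2.2.2 :=
      Computable.snd.comp (Computable.snd.comp Computable.snd)
    have hG : Computable fun x : List ℕ × ℕ × ℕ × List ℕ × ℤ × ℕ => x.2.2.2.1 :=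
      Computable.fst.comp hx1
    have hnum : Computable fun x : List ℕ × ℕ × ℕ × List ℕ × ℤ × ℕ =>
        Encodable.encode x.2.2.2.2.1 :=
      Computable.encode.comp (Computable.fst.comp (Computable.snd.comp hx1))
    have hden : Computable fun x : List ℕ × ℕ × ℕ × List ℕ × ℤ × ℕ => x.2.2.2.2.2 :=
      Computable.snd.comp (Computable.snd.comp hx1)
    have htarget := Computable.nat_div2.comp (hnum.comp (Computable.fst
      (β := ℕ × List (ℕ × ℕ) × ℕ)))
    refine Partrec.bind (hfind.comp ((Primrec.list_getD 0).to_comp.comp Computable.fst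
      (Computable.fst.comp Computable.snd))) ?_
    refine Partrec.map (Partrec.runFor hstep (B := (List ℕ × ℕ × ℕ × List ℕ × ℤ × ℕ) ×
      (ℕ × List (ℕ × ℕ) × ℕ)) ?_ ?_ htarget (Computable.succ.comp htarget)) ?_
    · exact (Computable.fst.comp (Computable.snd.comp hy)).pair
        ((Computable.fst.comp hy).pair (hG.comp Computable.fst))
    · exact (Computable.const 0).pair ((Computable.const 1).pair
        (Primrec.nat_mul.to_comp.comp (Computable.fst.comp hy)
          (Computable.snd.comp (Computable.snd.comp hy))))
    · refine Primrec.and.to_comp.comp (Primrec.and.to_comp.comp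
        (Computable.fst.comp Computable.snd) (Primrec.not.to_comp.comp
          (Computable.nat_bodd.comp (hnum.comp (Computable.fst.comp Computable.fst))))) ?_
      exact Primrec.beq.to_comp.comp (hden.comp (Computable.fst.comp Computable.fst))
        (Computable.const 1)
  · intro L i j a b hLi hconj hab gens E hE haE hbE
    have ha0 : a ≠ 0 := by
      rintro rfl
      exact hab hconj.eq_zero.symm
    obtain ⟨⟨c, l, n₀⟩, hy⟩ := hfind_ex (L.getD i 0) (by
      obtain ⟨c, hc, hA⟩ := exists_natCast_mul_isIntegral a
      obtain ⟨l, hl⟩ := exists_monicOfList_eq (minpoly.monic hA)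
      exact ⟨(c, l, ((monicOfList l).eval (-(c * (0 : ℕ) : ℤ))).natAbs), hc,
        by rw [hLi, Equiv.apply_symm_apply]; exact ⟨hA, hl.symm⟩, rfl⟩)
    obtain ⟨hc, ⟨hA, hmin⟩, hn₀⟩ := hfind_sound _ _ hy
    rw [hLi, Equiv.apply_symm_apply] at hA hmin
    simp only [Nat.cast_zero, mul_zero, neg_zero] at hc hA hmin hn₀
    have hA0 : (c : Qbar) * a ≠ 0 := mul_ne_zero (by exact_mod_cast hc) ha0
    have hgens : (gens.map ν.symm).map ν = gens := by simp
    -- The ℤ-algebra structure is named to match the lemmas stated for a general field.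
    have hmin' : @minpoly ℤ Qbar _ _ (Ring.toIntAlgebra Qbar) ((c : Qbar) * a) =
      monicOfList l := hmin
    obtain ⟨s, hs, hsT⟩ := exists_isSqrtRun (f := monicOfList l) (gens := gens) hc
      (by rw [← hmin']; exact eval_zero_minpoly_int_ne_zero hA hA0)
      (T := fun s t => t ∈ step ((l, c, gens.map ν.symm), s))
      (fun s t ht => by
        have := hstep_sound _ _ ht
        rwa [hgens] at this)
      (fun s h1 h2 => hstep_ex _ (by
        rw [hgens]
        simp only
        rw [← hmin']
        exact exists_sqrtStep_minpoly hA hA0 hc gens h1 h2))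
    have hs0 : s 0 = (0, 1, c * n₀) := by rw [hs.1, hn₀]
    have hdist : Distinguishes E a b {q | ∃ k, q = ((s (k + 1)).1 : ℚ)} :=
      IsSqrtRun.distinguishes hconj hab hE haE hbE hc hA (by rw [hmin]; exact hs)
    refine ⟨_, hs.infinite, hdist, fun q => ?_⟩
    have hrun := exists_mem_runFor hsT (Encodable.encode q.num).div2
      ((Encodable.encode q.num).div2 + 1)
    rw [hs0] at hrun
    have hiff := mem_run_iff hs.strictMono q
    refine ⟨fun hq => ?_, fun hq => ?_⟩
    · refine Part.mem_bind_iff.mpr ⟨_, hy, (Part.mem_map_iff _).mpr ⟨_, hrun, ?_⟩⟩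
      obtain ⟨⟨h1, h2⟩, h3⟩ := hiff.mp hq
      simp only [decide_eq_true h1, h2, h3]
      rfl
    · refine Part.mem_bind_iff.mpr ⟨_, hy, (Part.mem_map_iff _).mpr ⟨_, hrun, ?_⟩⟩
      have hq' := mt hiff.mpr hq
      rw [← Bool.not_eq_true]
      simpa [and_assoc] using hq'

end Decision

theorem lemma6p3 :
    (∀ (n : ℕ) (α : Fin (n + 1) → Qbar), (∀ s t, IsConjRoot ℚ (α s) (α t)) →
      ∀ (i j : Fin (n + 1)), α i ≠ α j →
      ∀ (E : IntermediateField ℚ Qbar), FiniteDimensional ℚ E → α i ∈ E → α j ∈ E →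
        ∃ D : Set ℚ, D.Infinite ∧ Distinguishes E (α i) (α j) D) ∧
    (∀ ν : ℕ ≃ Qbar, IsComputablePresentation ν →
      -- One procedure `dec` that works for all inputs: the codes of `α 0, …, α n`, the indices
      -- `i` and `j`, the codes of generators of `E`, and a rational number to be tested.
      ∃ dec : List ℕ × ℕ × ℕ × List ℕ × ℤ × ℕ →. Bool, Partrec dec ∧
        ∀ (n : ℕ) (α : Fin (n + 1) → Qbar), (∀ s t, IsConjRoot ℚ (α s) (α t)) →
        ∀ (i j : Fin (n + 1)), α i ≠ α j →
        ∀ (gens : List Qbar) (E : IntermediateField ℚ Qbar),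
          E = IntermediateField.adjoin ℚ {x | x ∈ gens} → α i ∈ E → α j ∈ E →
          ∃ D : Set ℚ, D.Infinite ∧ Distinguishes E (α i) (α j) D ∧
            ∀ q : ℚ,
              (q ∈ D → true ∈ dec (List.ofFn fun t => ν.symm (α t), (i : ℕ), (j : ℕ),
                gens.map ν.symm, q.num, q.den)) ∧
              (q ∉ D → false ∈ dec (List.ofFn fun t => ν.symm (α t), (i : ℕ), (j : ℕ),
                gens.map ν.symm, q.num, q.den))) := by
  refine ⟨fun n α hα i j hij E hE hi hj => ?_, fun ν hν => ?_⟩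
  -- A finite extension is generated by finitely many elements, which serve as the list of
  -- generators.
  · obtain ⟨S, hS⟩ := (IntermediateField.essFiniteType_iff (K := E)).mp inferInstance
    exact exists_infinite_distinguishes (gens := S.toList) (hα i j) hij
      (by rw [← hS]; congr 1; ext x; simp) hi hj
  · obtain ⟨dec, hdec, h⟩ := exists_decision (ν := ν) ⟨hν.add, hν.mul⟩
    refine ⟨dec, hdec, fun n α hα i j hij gens E hE hi hj => ?_⟩
    exact h _ _ _ (α i) (α j) (by
      rw [List.getD_eq_getElem _ _ (by simpa using i.is_le), List.getElem_ofFn]) (hα i j) hij gens E hE hi hj
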